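/- Let $(\mathbf X_t)_{t\in\mathbb Z}$ be a strictly stationary sequence of $\mathbb R^d$-valued random vectors, $|\cdot|$ the Euclidean norm, $\overline{\mathbb R}=[-\infty,\infty]$, $\overline{\mathbb R}{}_0^{k}=\overline{\mathbb R}{}^{k}\setminus\{\mathbf 0\}$, and $\mathbf Y_h=\mathrm{vec}(\mathbf X_1,\dots,\mathbf X_h)$. Assume that $(\mathbf X_t)$ is regularly varying with index $\alpha>0$: for every $h\ge1$ there is a non-null Radon measure $\mu_h$ on $\overline{\mathbb R}{}_0^{hd}$ with $\mu_h(tB)=t^{-\alpha}\mu_h(B)$ for all $t>0$ and all Borel sets $B$, such that, as $x\to\infty$, $$\frac{P(x^{-1}\mathbf Y_h\in\cdot)}{P(|\mathbf Y_h|>x)}\xrightarrow{v}\mu_h(\cdot)\quad\text{(vague convergence on }\overline{\mathbb R}{}_0^{hd}).$$ Let $\mu=\mu_1$, and let $(a_n)$ be a real sequence with $nP(|\mathbf X_0|>a_n)\to1$. Let $$\alpha_h=\sup_{s\in\mathbb Z}\ \sup\{|P(A\cap B)-P(A)P(B)|:A\in\sigma(\mathbf X_t,t\le s),\ B\in\sigma(\mathbf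 X_t,t\ge s+h)\}$$ be the strong mixing coefficients. Let $C\subset\overline{\mathbb R}{}^d$ be a Borel set which is bounded away from zero, i.e. $C\subset\{\mathbf x:|\mathbf x|>\epsilon\}$ for some $\epsilon>0$, and suppose that $\mu(\partial C)=0$ and $\mu_{h+1}(\partial(C\times\overline{\mathbb R}{}^{d(h-1)}\times C))=0$ for every $h\ge1$, where the boundaries are taken in $\overline{\mathbb R}{}_0^{d}$ and $\overline{\mathbb R}{}_0^{(h+1)d}$. Assume condition (M): $\alpha_h\to0$, and the integer sequences $m_n,r_n\to\infty$ satisfy $m_n/n\to0$, $r_n/m_n\to0$, $$\lim_{n\to\infty}m_n\sum_{h=r_n}^\infty\alpha_h=0,$$ and, for every $\epsilon>0$, $$\lim_{k\to\infty}\limsup_{n\to\infty}m_n\sum_{h=k}^{r_n}P(|\mathbf X_h|>\epsilon a_{m_n},|\mathbf X_0|>\epsilon a_{m_n})=0.$$ Put $k_n=n/m_n$ and assume that $k_n\alpha_{r_n}\to0$. Assume finally that either $m_n=o(n^{1/3})$, or $$\frac{m_n^4}{n}\sum_{j=r_n}^{m_n}\alpha_j\to0\quad\text{and}\quad\frac{m_nr_n^3}{n}\to0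 .$$ Then, for every $h\ge1$, the limit $c_h=\lim_{x\to\infty}P(|\mathbf Y_h|>x)/P(|\mathbf X_0|>x)$ exists in $(0,\infty)$; and with $\nu_h=c_h\mu_h$ (so that $\nu_1=\mu$), $\tau_h(C)=\nu_{h+1}(C\times\overline{\mathbb R}{}^{d(h-1)}\times C)$ and $$\sigma^2(C)=\mu(C)+2\sum_{h=1}^\infty\tau_h(C),$$ one has $\sigma^2(C)<\infty$ and $$\Big(\frac{m_n}{n}\Big)^{1/2}\sum_{t=1}^n\Big(I\{\mathbf X_t/a_{m_n}\in C\}-P(\mathbf X_0/a_{m_n}\in C)\Big)\xrightarrow{d}N(0,\sigma^2(C)),$$ where $N(0,0)$ is the point mass at $0$. -/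

import Mathlib

open MeasureTheory ProbabilityTheory Filter Topology
open scoped ENNReal NNReal CompactlySupported

namespace Extremogram

/-- The extended space `[-∞, ∞]^{hd}`, written as `h` blocks of length `d`. -/
abbrev Ext (h d : ℕ) : Type := Fin h → Fin d → EReal

/-- The punctured extended space `[-∞, ∞]^{hd} \ {0}`, with the subspace topology and the
Borel sigma-algebra. -/
abbrev Punctured (h d : ℕ) : Type := {y : Ext h d // y ≠ 0}

/-- The Euclidean norm on `[-∞, ∞]^d`; it is `∞` as soon as one coordinate is infinite. -/
noncomputable def extNorm {d : ℕ} (x : Fin d → EReal) : ℝ≥0∞ :=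
  (∑ i, (x i).abs ^ 2) ^ (1 / 2 : ℝ)

/-- `C ⊆ [-∞, ∞]^d` is bounded away from zero. -/
def BoundedAwayFromZero {d : ℕ} (C : Set (Fin d → EReal)) : Prop :=
  ∃ ε : ℝ, 0 < ε ∧ C ⊆ {x | ENNReal.ofReal ε < extNorm x}

/-- The vector `v / x` of `ℝ^d`, seen in `[-∞, ∞]^d`. -/
noncomputable def scaledPoint {d : ℕ} (x : ℝ) (v : EuclideanSpace ℝ (Fin d)) : Fin d → EReal :=
  fun j => ((v j / x : ℝ) : EReal)

section Series

variable {Ω : Type*} [MeasurableSpace Ω] {d : ℕ}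

/-- Strict stationarity: every time shift of the process has the same law (on the product space
`(ℝ^d)^ℤ`) as the process itself. -/
def StrictlyStationary (P : Measure Ω) (X : ℤ → Ω → EuclideanSpace ℝ (Fin d)) : Prop :=
  ∀ k : ℤ, IdentDistrib (fun ω (t : ℤ) => X (t + k) ω) (fun ω (t : ℤ) => X t ω) P P

/-- The Euclidean norm of the lagged vector `Y_h = vec(X_1, …, X_h)`. -/
noncomputable def lagNorm (X : ℤ → Ω → EuclideanSpace ℝ (Fin d)) (h : ℕ) (ω : Ω) : ℝ :=
  Real.sqrt (∑ i : Fin h, ‖X ((i : ℤ) + 1) ω‖ ^ 2)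

/-- The law of `x⁻¹ Y_h`, `Y_h = vec(X_1, …, X_h)`, restricted to `[-∞, ∞]^{hd} \ {0}`. -/
noncomputable def scaledLagLaw (P : Measure Ω) (X : ℤ → Ω → EuclideanSpace ℝ (Fin d))
    (h : ℕ) (x : ℝ) : Measure (Punctured h d) :=
  (P.map (fun ω (i : Fin h) => scaledPoint x (X ((i : ℤ) + 1) ω))).comap Subtype.val

/-- `(X_t)` is regularly varying with index `α > 0` and limiting measures `(μ_h)_{h ≥ 1}`:
for every `h ≥ 1`, `μ_h` is a non-null Radon measure on `[-∞, ∞]^{hd} \ {0}`, homogeneous of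
order `-α`, and `P(x⁻¹ Y_h ∈ ·) / P(|Y_h| > x)` converges vaguely to `μ_h` as `x → ∞`, that is,
the integrals of every compactly supported continuous function converge. -/
structure RegularlyVarying (P : Measure Ω) (X : ℤ → Ω → EuclideanSpace ℝ (Fin d)) (α : ℝ)
    (μ : (h : ℕ) → Measure (Punctured h d)) : Prop where
  index_pos : 0 < α
  radon : ∀ h, 1 ≤ h → IsFiniteMeasureOnCompacts (μ h)
  nonnull : ∀ h, 1 ≤ h → μ h ≠ 0
  homogeneous : ∀ h, 1 ≤ h → ∀ t : ℝ, 0 < t → ∀ B : Set (Ext h d), MeasurableSet B →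
    μ h (Subtype.val ⁻¹' ((fun y i j => (t : EReal) * y i j) '' B)) =
      ENNReal.ofReal (t ^ (-α)) * μ h (Subtype.val ⁻¹' B)
  vague : ∀ h, 1 ≤ h → ∀ f : C_c(Punctured h d, ℝ),
    Tendsto (fun x : ℝ => (∫ y, f y ∂(scaledLagLaw P X h x)) / P.real {ω | x < lagNorm X h ω})
      atTop (𝓝 (∫ y, f y ∂(μ h)))

/-- The strong (α-)mixing coefficient
`α_h = sup_s sup {|P(A ∩ B) - P(A) P(B)| : A ∈ σ(X_t, t ≤ s), B ∈ σ(X_t, t ≥ s + h)}`. -/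
noncomputable def alphaCoeff (P : Measure Ω) (X : ℤ → Ω → EuclideanSpace ℝ (Fin d))
    (h : ℕ) : ℝ :=
  sSup {x : ℝ | ∃ (s : ℤ) (A B : Set Ω),
    MeasurableSet[⨆ t ∈ Set.Iic s, MeasurableSpace.comap (X t) inferInstance] A ∧
    MeasurableSet[⨆ t ∈ Set.Ici (s + h), MeasurableSpace.comap (X t) inferInstance] B ∧
    x = |P.real (A ∩ B) - P.real A * P.real B|}

/-- The mixing and anti-clustering condition for the normalizing sequence `a` and the integer
sequences `m_n`, `r_n`: the process is α-mixing; `m_n, r_n → ∞`, `m_n / n → 0`, `r_n / m_n → 0`;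
`m_n ∑_{h ≥ r_n} α_h → 0` (the series being finite); and, for every `ε > 0`, the limit as `k → ∞`
of `limsup_n m_n ∑_{h=k}^{r_n} P(|X_h| > ε a_{m_n}, |X_0| > ε a_{m_n})` is zero. -/
structure ConditionM (P : Measure Ω) (X : ℤ → Ω → EuclideanSpace ℝ (Fin d)) (a : ℕ → ℝ)
    (m r : ℕ → ℕ) : Prop where
  mixing : Tendsto (alphaCoeff P X) atTop (𝓝 0)
  m_tendsto : Tendsto m atTop atTop
  r_tendsto : Tendsto r atTop atTop
  m_div_n : Tendsto (fun n : ℕ => (m n : ℝ) / n) atTop (𝓝 0)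
  r_div_m : Tendsto (fun n : ℕ => (r n : ℝ) / m n) atTop (𝓝 0)
  summable : Summable (alphaCoeff P X)
  tail_sum : Tendsto (fun n : ℕ => (m n : ℝ) * ∑' j : ℕ, alphaCoeff P X (r n + j)) atTop (𝓝 0)
  anticlustering : ∀ ε : ℝ, 0 < ε →
    Tendsto (fun k : ℕ => limsup (fun n : ℕ => (m n : ℝ≥0∞) * ∑ h ∈ Finset.Icc k (r n),
      P {ω | ε * a (m n) < ‖X h ω‖ ∧ ε * a (m n) < ‖X 0 ω‖}) atTop) atTop (𝓝 0)

/-- The normalized sum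
`S_n = (m_n / n)^{1/2} ∑_{t=1}^n (I{X_t / a_{m_n} ∈ C} - P(X_0 / a_{m_n} ∈ C))`. -/
noncomputable def normalizedSum (P : Measure Ω) (X : ℤ → Ω → EuclideanSpace ℝ (Fin d))
    (a : ℕ → ℝ) (m : ℕ → ℕ) (C : Set (Fin d → EReal)) (n : ℕ) (ω : Ω) : ℝ :=
  Real.sqrt ((m n : ℝ) / n) * ∑ t ∈ Finset.Icc 1 n,
    ({ω' | scaledPoint (a (m n)) (X (t : ℤ) ω') ∈ C}.indicator (fun _ => (1 : ℝ)) ω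
      - P.real {ω' | scaledPoint (a (m n)) (X 0 ω') ∈ C})

end Series

/-- The set `C` itself when `h = 0`, and `C × [-∞, ∞]^{d(h-1)} × C` when `h ≥ 1`, as a subset of
`[-∞, ∞]^{(h+1)d} \ {0}`. -/
def lagSet {d : ℕ} (C : Set (Fin d → EReal)) (h : ℕ) : Set (Punctured (h + 1) d) :=
  {y | y.1 0 ∈ C ∧ y.1 (Fin.last h) ∈ C}

/-- `τ_h(C) = ν_{h+1}(C × [-∞, ∞]^{d(h-1)} × C)`, where `ν_h = c_h μ_h`. -/
noncomputable def tau {d : ℕ} (c : ℕ → ℝ≥0) (μ : (h : ℕ) → Measure (Punctured h d))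
    (C : Set (Fin d → EReal)) (h : ℕ) : ℝ≥0∞ :=
  c (h + 1) * μ (h + 1) (lagSet C h)

/-- `σ²(C) = μ(C) + 2 ∑_{h ≥ 1} τ_h(C)`, with `μ = μ_1`. -/
noncomputable def sigmaSq {d : ℕ} (c : ℕ → ℝ≥0) (μ : (h : ℕ) → Measure (Punctured h d))
    (C : Set (Fin d → EReal)) : ℝ≥0∞ :=
  μ 1 (lagSet C 0) + 2 * ∑' h : ℕ, tau c μ C (h + 1)

end Extremogram

/-!
By regular variation `m n * P (X 0 ∈ D n, X h ∈ D n) → τ_h(C)`, where `D n = a (m n) • C`, and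
anticlustering together with the mixing rate makes the tail `h ≥ k` of `∑ m n * |cov|` uniformly
small, so that sums over lags converge termwise. Bernstein's blocking method uses blocks of an
intermediate length `L`, `r n ≪ L n ≪ m n`, separated by gaps of length `r n`. The gaps and the
remainder carry a vanishing share of the variance, and mixing decouples the characteristic function
of the sum over the blocks at a total cost `(n / L n) * α (r n) → 0`. Since `L n ≪ m n`, a block
typically contains no exceedance at all, and a large block sum forces two exceedances at distance at
least `k`; these are rare by anticlustering, which is the Lindeberg condition for the block sums.
-/

namespace Extremogram

section VagueConvergence

variable {E ι : Type*} [MeasurableSpace E] {L : Filter ι}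

theorem tendsto_finiteMeasure_apply_of_null_frontier [TopologicalSpace E]
    [OpensMeasurableSpace E] [HasOuterApproxClosed E] {μs : ι → FiniteMeasure E}
    {μ : FiniteMeasure E}
    (h : Tendsto μs L (𝓝 μ)) {B : Set E} (hB : (μ : Measure E) (frontier B) = 0) :
    Tendsto (fun i => μs i B) L (𝓝 (μ B)) := by
  by_cases h0 : μ = 0
  · subst h0
    exact tendsto_of_tendsto_of_tendsto_of_le_of_le tendsto_const_nhds (by simpa using h.mass)
      (fun i => by simp) fun i => (μs i).apply_le_mass B
  obtain ⟨x⟩ : Nonempty E := by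
    by_contra hE
    rw [not_nonempty_iff] at hE
    exact h0 (Subtype.ext (Measure.eq_zero_of_isEmpty (μ : Measure E)))
  have : Nonempty E := ⟨x⟩
  have hB' : (μ.normalize : Measure E) (frontier B) = 0 := by
    simp [μ.toMeasure_normalize_eq_of_nonzero h0, hB]
  have hnormalize := ProbabilityMeasure.tendsto_measure_of_null_frontier_of_tendsto
    (FiniteMeasure.tendsto_normalize_of_tendsto h h0)
    ((ProbabilityMeasure.null_iff_toMeasure_null _ _).2 hB')
  simpa only [← FiniteMeasure.self_eq_mass_mul_normalize] using h.mass.mul hnormalize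

theorem withDensity_ofReal_apply_of_eqOn_one {g : E → ℝ} {B : Set E} (hB : MeasurableSet B)
    (hg : Set.EqOn g 1 B) (ρ : Measure E) :
    ρ.withDensity (fun y => ENNReal.ofReal (g y)) B = ρ B := by
  rw [withDensity_apply _ hB, setLIntegral_congr_fun hB (g := 1) fun y hy => by simp [hg hy]]
  simp

theorem integral_withDensity_ofReal {g : E → ℝ} (hg : Measurable g) (hg0 : ∀ y, 0 ≤ g y)
    (ρ : Measure E) (f : E → ℝ) :
    ∫ y, f y ∂ρ.withDensity (fun y => ENNReal.ofReal (g y)) = ∫ y, g y * f y ∂ρ := by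
  rw [integral_withDensity_eq_integral_toReal_smul hg.ennreal_ofReal
    (ae_of_all _ fun _ => ENNReal.ofReal_lt_top)]
  simp [ENNReal.toReal_ofReal (hg0 _)]

/-- Multiplying all measures by a compactly supported weight equal to `1` on `K` turns vague
convergence into weak convergence of finite measures. -/
theorem tendsto_measureReal_of_vague [TopologicalSpace E] [BorelSpace E]
    [LocallyCompactSpace E] [TopologicalSpace.MetrizableSpace E] {Q : ι → Measure E}
    [∀ i, IsFiniteMeasureOnCompacts (Q i)]
    {μ : Measure E} [IsFiniteMeasureOnCompacts μ]
    (h : ∀ f : C_c(E, ℝ), Tendsto (fun i => ∫ y, f y ∂Q i) L (𝓝 (∫ y, f y ∂μ)))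
    {K B : Set E} (hK : IsCompact K) (hBK : B ⊆ K) (hB : MeasurableSet B)
    (hfr : μ (frontier B) = 0) :
    Tendsto (fun i => (Q i).real B) L (𝓝 (μ.real B)) := by
  let _ := TopologicalSpace.metrizableSpaceMetric E
  obtain ⟨g, hg1, -, hgc, hg01⟩ := exists_continuous_one_zero_of_isCompact hK isClosed_empty
    (Set.disjoint_empty K)
  have hgB : Set.EqOn g 1 B := hg1.mono hBK
  have hintegrable := integral_withDensity_ofReal g.continuous.measurable fun y => (hg01 y).1
  let weighted (ρ : Measure E) [IsFiniteMeasureOnCompacts ρ] : FiniteMeasure E :=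
    ⟨ρ.withDensity fun y => ENNReal.ofReal (g y), isFiniteMeasure_withDensity_ofReal
      (g.continuous.integrable_of_hasCompactSupport hgc).2⟩
  have hweak : Tendsto (fun i => weighted (Q i)) L (𝓝 (weighted μ)) := by
    refine FiniteMeasure.tendsto_of_forall_integral_tendsto fun f => ?_
    simp only [weighted, FiniteMeasure.toMeasure_mk, hintegrable]
    exact h ⟨⟨fun y => g y * f y, by fun_prop⟩, hgc.mul_right⟩
  have hreal (ρ : Measure E) [IsFiniteMeasureOnCompacts ρ] :
      (weighted ρ B : ℝ) = ρ.real B := by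
    rw [measureReal_def, ← withDensity_ofReal_apply_of_eqOn_one hB hgB ρ]
    rfl
  have hlim := tendsto_finiteMeasure_apply_of_null_frontier hweak
    (withDensity_absolutelyContinuous μ _ hfr)
  simpa only [Function.comp_def, hreal] using (NNReal.continuous_coe.tendsto _).comp hlim

end VagueConvergence

section ExtendedSpace

variable {h d : ℕ}

instance instSecondCountablePunctured (h d : ℕ) : SecondCountableTopology (Punctured h d) :=
  TopologicalSpace.Subtype.secondCountableTopology {y : Ext h d | y ≠ 0}

instance instMetrizablePunctured (h d : ℕ) : TopologicalSpace.MetrizableSpace (Punctured h d) :=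
  TopologicalSpace.metrizableSpace_of_t3_secondCountable _

instance instLocallyCompactPunctured (h d : ℕ) : LocallyCompactSpace (Punctured h d) :=
  (isOpen_compl_singleton (x := (0 : Ext h d))).isOpenEmbedding_subtypeVal.locallyCompactSpace

theorem measurableEmbedding_punctured (h d : ℕ) :
    MeasurableEmbedding (Subtype.val : Punctured h d → Ext h d) :=
  MeasurableEmbedding.subtype_coe (measurableSet_singleton (0 : Ext h d)).compl

theorem continuous_ereal_abs : Continuous EReal.abs := by
  have : EReal.abs = fun x : EReal => max x.toENNReal (-x).toENNReal := by
    funext x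
    induction x with
    | bot => simp
    | top => simp
    | coe x => simp [EReal.abs_def, ← EReal.coe_neg, EReal.toENNReal_of_ne_top,
        ← ENNReal.ofReal_max, abs_eq_max_neg]
  rw [this]
  fun_prop

theorem continuous_extNorm : Continuous (extNorm : (Fin d → EReal) → ℝ≥0∞) :=
  ENNReal.continuous_rpow_const.comp <| continuous_finsetSum _ fun i _ =>
    (ENNReal.continuous_pow 2).comp (continuous_ereal_abs.comp (continuous_apply i))

theorem extNorm_eq_zero {x : Fin d → EReal} : extNorm x = 0 ↔ x = 0 := by
  simp [extNorm, ENNReal.rpow_eq_zero_iff, funext_iff]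

theorem extNorm_mul {t : ℝ} (ht : 0 < t) (x : Fin d → EReal) :
    extNorm (fun j => (t : EReal) * x j) = ENNReal.ofReal t * extNorm x := by
  simp only [extNorm, EReal.abs_mul, mul_pow, ← Finset.mul_sum]
  rw [ENNReal.mul_rpow_of_nonneg _ _ (by norm_num), EReal.abs_def, abs_of_pos ht,
    ← ENNReal.rpow_natCast, ← ENNReal.rpow_mul]
  norm_num

theorem extNorm_scaledPoint {x : ℝ} (hx : 0 < x) (v : EuclideanSpace ℝ (Fin d)) :
    extNorm (scaledPoint x v) = ENNReal.ofReal (‖v‖ / x) := by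
  have hcoord : ∀ i, (scaledPoint x v i).abs ^ 2 = ENNReal.ofReal ((v i / x) ^ 2) := fun i => by
    rw [scaledPoint, EReal.abs_def, ← ENNReal.ofReal_pow (abs_nonneg _), sq_abs]
  rw [extNorm, Finset.sum_congr rfl fun i _ => hcoord i,
    ← ENNReal.ofReal_sum_of_nonneg fun i _ => sq_nonneg _,
    ENNReal.ofReal_rpow_of_nonneg (Finset.sum_nonneg fun i _ => sq_nonneg _) (by norm_num),
    ← Real.sqrt_eq_rpow, EuclideanSpace.norm_eq]
  simp only [div_pow, ← Finset.sum_div, Real.norm_eq_abs, sq_abs]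
  rw [Real.sqrt_div (Finset.sum_nonneg fun i _ => sq_nonneg _), Real.sqrt_sq hx.le]

theorem isCompact_le_extNorm (i : Fin h) {ε : ℝ≥0∞} (hε : 0 < ε) :
    IsCompact {y : Punctured h d | ε ≤ extNorm (y.1 i)} := by
  have hclosed : IsClosed {y : Ext h d | ε ≤ extNorm (y i)} :=
    isClosed_le continuous_const (continuous_extNorm.comp (continuous_apply i))
  refine Topology.IsInducing.subtypeVal.isCompact_preimage' hclosed.isCompact fun y hy => ?_
  refine ⟨⟨y, ?_⟩, rfl⟩
  rintro rfl
  exact hε.not_ge (hy.trans (extNorm_eq_zero.2 rfl).le)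

theorem isOpen_lt_extNorm (i : Fin h) (ε : ℝ≥0∞) :
    IsOpen {y : Punctured h d | ε < extNorm (y.1 i)} :=
  isOpen_lt continuous_const
    (continuous_extNorm.comp ((continuous_apply i).comp continuous_subtype_val))

theorem measurableSet_lt_extNorm (i : Fin h) (ε : ℝ≥0∞) :
    MeasurableSet {y : Ext h d | ε < extNorm (y i)} :=
  (isOpen_lt continuous_const (continuous_extNorm.comp (continuous_apply i))).measurableSet

theorem image_mul_lt_extNorm (i : Fin h) {t : ℝ} (ht : 0 < t) :
    (fun (y : Ext h d) i j => (t : EReal) * y i j) '' {y | 1 < extNorm (y i)} =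
      {y | ENNReal.ofReal t < extNorm (y i)} := by
  have hscale : ∀ y : Ext h d, 1 < extNorm (y i) ↔
      ENNReal.ofReal t < extNorm (fun j => (t : EReal) * y i j) := fun y => by
    rw [extNorm_mul ht]
    nth_rewrite 1 [← mul_one (ENNReal.ofReal t)]
    exact (ENNReal.mul_lt_mul_iff_right (by simpa using ht) ENNReal.ofReal_ne_top).symm
  refine Set.Subset.antisymm (Set.image_subset_iff.2 fun y hy => (hscale y).1 hy) fun z hz => ?_
  have hinv : ∀ w : EReal, (t : EReal) * ((t⁻¹ : ℝ) * w) = w := fun w => by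
    rw [← mul_assoc, ← EReal.coe_mul, mul_inv_cancel₀ ht.ne', EReal.coe_one, one_mul]
  refine ⟨fun i j => ((t⁻¹ : ℝ) : EReal) * z i j, ?_, by simp only [hinv]⟩
  simpa only [Set.mem_ofPred_eq, hscale, hinv] using hz

theorem measurable_scaledPoint (x : ℝ) :
    Measurable (scaledPoint x : EuclideanSpace ℝ (Fin d) → Fin d → EReal) := by
  unfold scaledPoint
  fun_prop

end ExtendedSpace

section Stationarity

variable {Ω : Type*} [MeasurableSpace Ω] {P : Measure Ω} {d : ℕ}
  {X : ℤ → Ω → EuclideanSpace ℝ (Fin d)}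

theorem StrictlyStationary.measureReal_eq (hstat : StrictlyStationary P X) (k : ℤ)
    {S : Set (ℤ → EuclideanSpace ℝ (Fin d))} (hS : MeasurableSet S) :
    P.real {ω | (fun t => X (t + k) ω) ∈ S} = P.real {ω | (fun t => X t ω) ∈ S} :=
  congrArg ENNReal.toReal ((hstat k).measure_mem_eq hS)

theorem StrictlyStationary.integral_eq {E : Type*} [NormedAddCommGroup E] [NormedSpace ℝ E]
    [MeasurableSpace E] [BorelSpace E] (hstat : StrictlyStationary P X) (k : ℤ)
    {f : (ℤ → EuclideanSpace ℝ (Fin d)) → E} (hf : Measurable f) :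
    ∫ ω, f (fun t => X (t + k) ω) ∂P = ∫ ω, f (fun t => X t ω) ∂P :=
  ((hstat k).comp hf).integral_eq

theorem StrictlyStationary.measureReal_norm (hstat : StrictlyStationary P X) (k : ℤ) (x : ℝ) :
    P.real {ω | x < ‖X k ω‖} = P.real {ω | x < ‖X 0 ω‖} := by
  simpa using hstat.measureReal_eq k (S := {f | x < ‖f 0‖})
    (measurableSet_lt measurable_const (by fun_prop))

end Stationarity

section RegularVariation

variable {Ω : Type*} [MeasurableSpace Ω] {P : Measure Ω} {d : ℕ}
  {X : ℤ → Ω → EuclideanSpace ℝ (Fin d)} {α : ℝ} {μ : (h : ℕ) → Measure (Punctured h d)}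

theorem RegularlyVarying.measure_lt_extNorm (hreg : RegularlyVarying P X α μ) {h : ℕ} (hh : 1 ≤ h)
    (i : Fin h) {t : ℝ} (ht : 0 < t) :
    μ h {y | ENNReal.ofReal t < extNorm (y.1 i)} =
      ENNReal.ofReal (t ^ (-α)) * μ h {y | 1 < extNorm (y.1 i)} := by
  have hhom := hreg.homogeneous h hh t ht _ (measurableSet_lt_extNorm i 1)
  rwa [image_mul_lt_extNorm i ht] at hhom

theorem RegularlyVarying.measure_ne_top (hreg : RegularlyVarying P X α μ) {h : ℕ} (hh : 1 ≤ h)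
    (i : Fin h) {ε : ℝ≥0∞} (hε : 0 < ε) {B : Set (Punctured h d)}
    (hB : B ⊆ {y | ε ≤ extNorm (y.1 i)}) : μ h B ≠ ∞ := by
  have := hreg.radon h hh
  exact ((measure_mono hB).trans_lt (isCompact_le_extNorm i hε).measure_lt_top).ne

theorem RegularlyVarying.measure_one_lt_extNorm_ne_top (hreg : RegularlyVarying P X α μ) {h : ℕ}
    (hh : 1 ≤ h) (i : Fin h) : μ h {y | 1 < extNorm (y.1 i)} ≠ ∞ :=
  hreg.measure_ne_top hh i one_pos fun y (hy : 1 < extNorm (y.1 i)) => hy.le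

/-- By homogeneity, the closure has measure at most `t ^ (-α) * μ_h {1 < |y_i|}` for every
`t < 1`. -/
theorem RegularlyVarying.measure_frontier_one_lt_extNorm (hreg : RegularlyVarying P X α μ) {h : ℕ}
    (hh : 1 ≤ h) (i : Fin h) : μ h (frontier {y | 1 < extNorm (y.1 i)}) = 0 := by
  set G : Set (Punctured h d) := {y | 1 < extNorm (y.1 i)}
  have hfin : μ h G ≠ ∞ := hreg.measure_one_lt_extNorm_ne_top hh i
  have hsub : closure G ⊆ {y | 1 ≤ extNorm (y.1 i)} :=
    closure_minimal (fun y (hy : 1 < extNorm (y.1 i)) => hy.le) (isClosed_le continuous_const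
      (continuous_extNorm.comp ((continuous_apply i).comp continuous_subtype_val)))
  have hlim : Tendsto (fun t : ℝ => ENNReal.ofReal (t ^ (-α)) * μ h G) (𝓝[<] 1) (𝓝 (μ h G)) := by
    have hpow := ((Real.continuousAt_rpow_const 1 (-α) (Or.inl one_ne_zero)).tendsto).mono_left
      (nhdsWithin_le_nhds (s := Set.Iio 1))
    simpa using ENNReal.Tendsto.mul_const (ENNReal.tendsto_ofReal hpow) (Or.inr hfin)
  have hle : μ h (closure G) ≤ μ h G := by
    refine ge_of_tendsto hlim ?_
    filter_upwards [Ioo_mem_nhdsLT (zero_lt_one (α := ℝ))] with t ht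
    rw [← hreg.measure_lt_extNorm hh i ht.1]
    exact measure_mono fun y hy => (ENNReal.ofReal_lt_one.2 ht.2).trans_le (hsub hy)
  rw [frontier, (isOpen_lt_extNorm i 1).interior_eq,
    measure_sdiff subset_closure (isOpen_lt_extNorm i 1).nullMeasurableSet hfin]
  exact tsub_eq_zero_of_le hle

theorem RegularlyVarying.exists_measure_one_lt_extNorm_ne_zero (hreg : RegularlyVarying P X α μ)
    {h : ℕ} (hh : 1 ≤ h) : ∃ i, μ h {y | 1 < extNorm (y.1 i)} ≠ 0 := by
  by_contra! hzero
  have hnull : ∀ (i : Fin h) (n : ℕ),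
      μ h {y | ENNReal.ofReal (1 / ((n : ℝ) + 1)) < extNorm (y.1 i)} = 0 := fun i n => by
    rw [hreg.measure_lt_extNorm hh i (by positivity), hzero i, mul_zero]
  refine hreg.nonnull h hh (Measure.measure_univ_eq_zero.1 (measure_mono_null ?_
    (measure_iUnion_null fun i => measure_iUnion_null fun n => hnull i n)))
  rintro ⟨y, hy⟩ -
  obtain ⟨i, hi⟩ := Function.ne_iff.1 hy
  have hpos : 0 < extNorm (y i) := pos_iff_ne_zero.2 (extNorm_eq_zero.not.2 hi)
  have hlim : Tendsto (fun n : ℕ => ENNReal.ofReal (1 / ((n : ℝ) + 1))) atTop (𝓝 0) := by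
    simpa using ENNReal.tendsto_ofReal (tendsto_one_div_add_atTop_nhds_zero_nat (𝕜 := ℝ))
  obtain ⟨n, hn⟩ := (hlim.eventually_lt_const hpos).exists
  exact Set.mem_iUnion.2 ⟨i, Set.mem_iUnion.2 ⟨n, hn⟩⟩

theorem BoundedAwayFromZero.exists_lagSet_subset {C : Set (Fin d → EReal)}
    (hC : BoundedAwayFromZero C) (h : ℕ) :
    ∃ ε : ℝ≥0∞, 0 < ε ∧ {y : Ext (h + 1) d | y 0 ∈ C ∧ y (Fin.last h) ∈ C} ⊆
      {y | ε ≤ extNorm (y 0)} := by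
  obtain ⟨ε, hε, hsub⟩ := hC
  exact ⟨_, ENNReal.ofReal_pos.2 hε, fun y hy => (show _ < extNorm (y 0) from hsub hy.1).le⟩

theorem RegularlyVarying.tau_ne_top (hreg : RegularlyVarying P X α μ) {C : Set (Fin d → EReal)}
    (hC0 : BoundedAwayFromZero C) (c : ℕ → ℝ≥0) (h : ℕ) : tau c μ C h ≠ ∞ := by
  obtain ⟨ε, hε, hsub⟩ := hC0.exists_lagSet_subset h
  exact ENNReal.mul_ne_top ENNReal.coe_ne_top
    (hreg.measure_ne_top h.succ_pos 0 hε fun y hy => hsub hy)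

theorem isFiniteMeasure_scaledLagLaw [IsFiniteMeasure P] (h : ℕ) (x : ℝ) :
    IsFiniteMeasure (scaledLagLaw P X h x) :=
  ⟨by rw [scaledLagLaw, (measurableEmbedding_punctured h d).comap_apply]
      exact measure_lt_top _ _⟩

theorem scaledLagLaw_real (hX : ∀ t, Measurable (X t)) {h : ℕ} (x : ℝ) {S : Set (Ext h d)}
    (hS : MeasurableSet S) (h0 : (0 : Ext h d) ∉ S) :
    (scaledLagLaw P X h x).real (Subtype.val ⁻¹' S) =
      P.real {ω | (fun i : Fin h => scaledPoint x (X ((i : ℤ) + 1) ω)) ∈ S} := by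
  have hY : Measurable fun ω (i : Fin h) => scaledPoint x (X ((i : ℤ) + 1) ω) :=
    measurable_pi_lambda _ fun i => (measurable_scaledPoint x).comp (hX _)
  have himage : Subtype.val '' (Subtype.val ⁻¹' S : Set (Punctured h d)) = S :=
    Set.image_preimage_eq_of_subset fun y hy => ⟨⟨y, ne_of_mem_of_not_mem hy h0⟩, rfl⟩
  rw [measureReal_def, measureReal_def, scaledLagLaw,
    (measurableEmbedding_punctured h d).comap_apply, himage, Measure.map_apply hY hS]
  rfl

theorem RegularlyVarying.tendsto_event [IsFiniteMeasure P] (hX : ∀ t, Measurable (X t))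
    (hreg : RegularlyVarying P X α μ) {h : ℕ} (hh : 1 ≤ h) (i : Fin h) {ε : ℝ≥0∞} (hε : 0 < ε)
    {S : Set (Ext h d)} (hS : MeasurableSet S) (hSε : S ⊆ {y | ε ≤ extNorm (y i)})
    (hfr : μ h (frontier (Subtype.val ⁻¹' S)) = 0) :
    Tendsto (fun x : ℝ => P.real {ω | (fun i : Fin h => scaledPoint x (X ((i : ℤ) + 1) ω)) ∈ S} /
      P.real {ω | x < lagNorm X h ω}) atTop (𝓝 ((μ h).real (Subtype.val ⁻¹' S))) := by
  have h0 : (0 : Ext h d) ∉ S := fun hmem =>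
    hε.not_ge ((hSε hmem).trans (extNorm_eq_zero.2 rfl).le)
  let N (x : ℝ) : ℝ≥0 := (P.real {ω | x < lagNorm X h ω})⁻¹.toNNReal
  have hN (x : ℝ) : (N x : ℝ) = (P.real {ω | x < lagNorm X h ω})⁻¹ :=
    Real.coe_toNNReal _ (inv_nonneg.2 measureReal_nonneg)
  have hfinite (x : ℝ) := isFiniteMeasure_scaledLagLaw (P := P) (X := X) h x
  have := hreg.radon h hh
  have hlim := tendsto_measureReal_of_vague (L := atTop) (Q := fun x => N x • scaledLagLaw P X h x)
    (fun f => (hreg.vague h hh f).congr fun x => by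
      rw [integral_smul_nnreal_measure, NNReal.smul_def, hN, div_eq_inv_mul, smul_eq_mul])
    (isCompact_le_extNorm i hε) (B := Subtype.val ⁻¹' S) (fun y hy => hSε hy)
    (measurable_subtype_coe hS) hfr
  refine hlim.congr fun x => ?_
  rw [measureReal_nnreal_smul_apply, hN, scaledLagLaw_real hX _ hS h0, div_eq_inv_mul]

end RegularVariation

section LimitRatios

variable {Ω : Type*} [MeasurableSpace Ω] {P : Measure Ω} [IsFiniteMeasure P] {d : ℕ}
  {X : ℤ → Ω → EuclideanSpace ℝ (Fin d)} {α : ℝ} {μ : (h : ℕ) → Measure (Punctured h d)}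

theorem RegularlyVarying.tendsto_norm_div_lagNorm (hX : ∀ t, Measurable (X t))
    (hstat : StrictlyStationary P X) (hreg : RegularlyVarying P X α μ) {h : ℕ} (hh : 1 ≤ h)
    (i : Fin h) :
    Tendsto (fun x : ℝ => P.real {ω | x < ‖X 0 ω‖} / P.real {ω | x < lagNorm X h ω}) atTop
      (𝓝 ((μ h).real {y | 1 < extNorm (y.1 i)})) := by
  refine (hreg.tendsto_event hX hh i one_pos (measurableSet_lt_extNorm i 1)
    (fun y (hy : 1 < extNorm (y i)) => hy.le)
    (hreg.measure_frontier_one_lt_extNorm hh i)).congr' ?_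
  filter_upwards [eventually_gt_atTop 0] with x hx
  rw [← hstat.measureReal_norm ((i : ℤ) + 1) x]
  simp only [extNorm_scaledPoint hx, ENNReal.one_lt_ofReal, one_lt_div hx]

theorem RegularlyVarying.exists_tendsto_lagNorm_div_norm (hX : ∀ t, Measurable (X t))
    (hstat : StrictlyStationary P X) (hreg : RegularlyVarying P X α μ) {h : ℕ} (hh : 1 ≤ h) :
    ∃ c : ℝ≥0, 0 < c ∧
      Tendsto (fun x : ℝ => P.real {ω | x < lagNorm X h ω} / P.real {ω | x < ‖X 0 ω‖})
        atTop (𝓝 (c : ℝ)) := by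
  obtain ⟨i, hi⟩ := hreg.exists_measure_one_lt_extNorm_ne_zero hh
  have hpos : 0 < (μ h).real {y | 1 < extNorm (y.1 i)} :=
    ENNReal.toReal_pos hi (hreg.measure_one_lt_extNorm_ne_top hh i)
  have hlim := (hreg.tendsto_norm_div_lagNorm hX hstat hh i).inv₀ hpos.ne'
  simp only [inv_div] at hlim
  exact ⟨⟨_, (inv_pos.2 hpos).le⟩, inv_pos.2 hpos, hlim⟩

omit [MeasurableSpace Ω] in
theorem lagNorm_one (ω : Ω) : lagNorm X 1 ω = ‖X 1 ω‖ := by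
  simp [lagNorm]

omit [MeasurableSpace Ω] in
theorem norm_le_lagNorm {h : ℕ} (hh : 1 ≤ h) (ω : Ω) : ‖X 1 ω‖ ≤ lagNorm X h ω :=
  Real.le_sqrt_of_sq_le <| by
    simpa using Finset.single_le_sum (f := fun i : Fin h => ‖X ((i : ℤ) + 1) ω‖ ^ 2)
      (fun i _ => sq_nonneg _) (Finset.mem_univ ⟨0, hh⟩)

theorem RegularlyVarying.measureReal_lt_norm_pos (hX : ∀ t, Measurable (X t))
    (hstat : StrictlyStationary P X) (hreg : RegularlyVarying P X α μ) (x : ℝ) :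
    0 < P.real {ω | x < ‖X 0 ω‖} := by
  obtain ⟨c, hc, hlim⟩ := hreg.exists_tendsto_lagNorm_div_norm hX hstat le_rfl
  obtain ⟨y, hy, hxy⟩ := ((hlim.eventually_const_lt (NNReal.coe_pos.2 hc)).and
    (eventually_ge_atTop x)).exists
  have hypos : 0 < P.real {ω | y < ‖X 0 ω‖} :=
    measureReal_nonneg.lt_of_ne fun h0 => by simp [← h0] at hy
  exact hypos.trans_le (measureReal_mono fun ω (hω : y < ‖X 0 ω‖) => hxy.trans_lt hω)

theorem RegularlyVarying.measureReal_lt_lagNorm_pos (hX : ∀ t, Measurable (X t))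
    (hstat : StrictlyStationary P X) (hreg : RegularlyVarying P X α μ) {h : ℕ} (hh : 1 ≤ h)
    (x : ℝ) : 0 < P.real {ω | x < lagNorm X h ω} := by
  refine (hreg.measureReal_lt_norm_pos hX hstat x).trans_le ?_
  rw [← hstat.measureReal_norm 1 x]
  exact measureReal_mono fun ω (hω : x < ‖X 1 ω‖) => hω.trans_le (norm_le_lagNorm hh ω)

theorem RegularlyVarying.eq_one_of_tendsto (hX : ∀ t, Measurable (X t))
    (hstat : StrictlyStationary P X) (hreg : RegularlyVarying P X α μ) {c : ℝ}
    (hc : Tendsto (fun x : ℝ => P.real {ω | x < lagNorm X 1 ω} / P.real {ω | x < ‖X 0 ω‖})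
      atTop (𝓝 c)) : c = 1 := by
  refine tendsto_nhds_unique hc (tendsto_const_nhds.congr fun x => ?_)
  simp only [lagNorm_one]
  rw [hstat.measureReal_norm 1 x, div_self (hreg.measureReal_lt_norm_pos hX hstat x).ne']

theorem RegularlyVarying.threshold_tendsto_atTop (hX : ∀ t, Measurable (X t))
    (hstat : StrictlyStationary P X) (hreg : RegularlyVarying P X α μ) {a : ℕ → ℝ}
    (ha : Tendsto (fun n : ℕ => (n : ℝ) * P.real {ω | a n < ‖X 0 ω‖}) atTop (𝓝 1)) :
    Tendsto a atTop atTop := by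
  have htail : Tendsto (fun n : ℕ => P.real {ω | a n < ‖X 0 ω‖}) atTop (𝓝 0) := by
    have hmul := ha.mul (tendsto_inv_atTop_nhds_zero_nat (𝕜 := ℝ))
    rw [mul_zero] at hmul
    refine hmul.congr' ?_
    filter_upwards [eventually_ne_atTop 0] with n hn
    field_simp
  refine tendsto_atTop.2 fun x => ?_
  filter_upwards [htail.eventually_lt_const (hreg.measureReal_lt_norm_pos hX hstat x)] with n hn
  by_contra! hlt
  exact hn.not_ge (measureReal_mono fun ω (hω : x < ‖X 0 ω‖) => hlt.trans hω)

theorem measurableSet_joint_exceedance {C : Set (Fin d → EReal)} (hC : MeasurableSet C) (x : ℝ)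
    (h : ℤ) : MeasurableSet {f : ℤ → EuclideanSpace ℝ (Fin d) |
      scaledPoint x (f 0) ∈ C ∧ scaledPoint x (f h) ∈ C} :=
  (((measurable_scaledPoint x).comp (measurable_pi_apply 0)) hC).inter
    (((measurable_scaledPoint x).comp (measurable_pi_apply h)) hC)

theorem RegularlyVarying.tendsto_joint_exceedance (hX : ∀ t, Measurable (X t))
    (hstat : StrictlyStationary P X) (hreg : RegularlyVarying P X α μ) {a : ℕ → ℝ}
    (ha : Tendsto (fun n : ℕ => (n : ℝ) * P.real {ω | a n < ‖X 0 ω‖}) atTop (𝓝 1))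
    {C : Set (Fin d → EReal)} (hC : MeasurableSet C) (hC0 : BoundedAwayFromZero C) {h : ℕ}
    (hfr : μ (h + 1) (frontier (lagSet C h)) = 0) {c : ℕ → ℝ≥0}
    (hc : Tendsto (fun x : ℝ => P.real {ω | x < lagNorm X (h + 1) ω} / P.real {ω | x < ‖X 0 ω‖})
      atTop (𝓝 (c (h + 1)))) :
    Tendsto (fun n : ℕ => (n : ℝ) * P.real {ω | scaledPoint (a n) (X 0 ω) ∈ C ∧
      scaledPoint (a n) (X h ω) ∈ C}) atTop (𝓝 (tau c μ C h).toReal) := by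
  obtain ⟨ε, hε, hsub⟩ := hC0.exists_lagSet_subset h
  have hmeas : MeasurableSet {y : Ext (h + 1) d | y 0 ∈ C ∧ y (Fin.last h) ∈ C} :=
    (measurable_pi_apply 0 hC).inter (measurable_pi_apply (Fin.last h) hC)
  have hevent := hreg.tendsto_event hX h.succ_pos 0 hε hmeas hsub hfr
  have hatop := hreg.threshold_tendsto_atTop hX hstat ha
  have hprod := (ha.mul (hc.comp hatop)).mul (hevent.comp hatop)
  have htau : 1 * (c (h + 1) : ℝ) * (μ (h + 1)).real (lagSet C h) = (tau c μ C h).toReal := by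
    rw [one_mul, tau, ENNReal.toReal_mul, ENNReal.coe_toReal, measureReal_def]
  rw [← htau]
  refine hprod.congr fun n => ?_
  have hshift := hstat.measureReal_eq 1 (measurableSet_joint_exceedance hC (a n) h)
  simp only [Set.mem_ofPred_eq, zero_add] at hshift
  rw [← hshift]
  simp only [Function.comp_apply]
  have hnorm := (hreg.measureReal_lt_norm_pos hX hstat (a n)).ne'
  have hlag := (hreg.measureReal_lt_lagNorm_pos hX hstat h.succ_pos (a n)).ne'
  field_simp
  simp

end LimitRatios

section CovarianceInequality

variable {Ω : Type*} {m₁ m₂ mΩ : MeasurableSpace Ω} {P : Measure Ω}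

theorem integral_abs_condExp_le [IsFiniteMeasure P] (h₁ : m₁ ≤ mΩ) {w : Ω → ℝ} {a : ℝ}
    (hw : Integrable w P) (hA : ∀ A, MeasurableSet[m₁] A → |∫ ω in A, w ω ∂P| ≤ a) :
    ∫ ω, |(P[w | m₁]) ω| ∂P ≤ 2 * a := by
  have hpos : MeasurableSet[m₁] {ω | 0 ≤ (P[w | m₁]) ω} :=
    measurableSet_le measurable_const stronglyMeasurable_condExp.measurable
  have hneg : MeasurableSet[m₁] {ω | (P[w | m₁]) ω ≤ 0} :=
    measurableSet_le stronglyMeasurable_condExp.measurable measurable_const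
  calc ∫ ω, |(P[w | m₁]) ω| ∂P
      = ∫ ω in {ω | 0 ≤ (P[w | m₁]) ω}, w ω ∂P - ∫ ω in {ω | (P[w | m₁]) ω ≤ 0}, w ω ∂P := by
        rw [← setIntegral_condExp h₁ hw hpos, ← setIntegral_condExp h₁ hw hneg]
        exact integral_norm_eq_pos_sub_neg integrable_condExp
    _ ≤ 2 * a := by linarith [(abs_le.1 (hA _ hpos)).2, (abs_le.1 (hA _ hneg)).1]

theorem integral_norm_condExp_le [IsFiniteMeasure P] (h₁ : m₁ ≤ mΩ) {w : Ω → ℂ} {a : ℝ}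
    (hw : Integrable w P) (hA : ∀ A, MeasurableSet[m₁] A → ‖∫ ω in A, w ω ∂P‖ ≤ a) :
    ∫ ω, ‖(P[w | m₁]) ω‖ ∂P ≤ 4 * a := by
  have hre := integral_abs_condExp_le h₁ hw.re fun A hA' => by
    rw [integral_re hw.integrableOn]
    exact (Complex.abs_re_le_norm _).trans (hA A hA')
  have him := integral_abs_condExp_le h₁ hw.im fun A hA' => by
    rw [integral_im hw.integrableOn]
    exact (Complex.abs_im_le_norm _).trans (hA A hA')
  have hle : ∫ ω, ‖(P[w | m₁]) ω‖ ∂P ≤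
      ∫ ω, |(P[fun ω => RCLike.re (w ω) | m₁]) ω| + |(P[fun ω => RCLike.im (w ω) | m₁]) ω| ∂P := by
    refine integral_mono_ae integrable_condExp.norm
      (integrable_condExp.abs.add integrable_condExp.abs) ?_
    filter_upwards [Complex.reCLM.comp_condExp_comm hw (m := m₁),
      Complex.imCLM.comp_condExp_comm hw (m := m₁)] with ω hωre hωim
    exact (Complex.norm_le_abs_re_add_abs_im _).trans
      (add_le_add (congrArg abs hωre).le (congrArg abs hωim).le)
  rw [integral_add integrable_condExp.abs integrable_condExp.abs] at hle
  linarith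

theorem norm_integral_mul_le_integral_norm_condExp [IsFiniteMeasure P] (h₁ : m₁ ≤ mΩ)
    {f w : Ω → ℂ} (hf : Measurable[m₁] f) (hf1 : ∀ ω, ‖f ω‖ ≤ 1) (hw : Integrable w P) :
    ‖∫ ω, f ω * w ω ∂P‖ ≤ ∫ ω, ‖(P[w | m₁]) ω‖ ∂P := by
  have hfw : Integrable (fun ω => f ω * w ω) P :=
    hw.bdd_mul (hf.mono h₁ le_rfl).aestronglyMeasurable (ae_of_all _ hf1)
  rw [← integral_condExp h₁]
  refine norm_integral_le_of_norm_le integrable_condExp.norm ?_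
  filter_upwards [condExp_bilin_of_stronglyMeasurable_left (ContinuousLinearMap.mul ℝ ℂ)
    hf.stronglyMeasurable hfw hw] with ω hω
  exact (congrArg norm hω).le.trans ((norm_mul _ _).le.trans
    (mul_le_of_le_one_left (norm_nonneg _) (hf1 ω)))

/-- `a` bounds the dependence between the sigma-algebras `m₁` and `m₂`, in the sense of the strong
mixing coefficient. -/
def MixingBound (m₁ m₂ : MeasurableSpace Ω) {_ : MeasurableSpace Ω} (P : Measure Ω) (a : ℝ) :
    Prop :=
  ∀ A B, MeasurableSet[m₁] A → MeasurableSet[m₂] B →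
    |P.real (A ∩ B) - P.real A * P.real B| ≤ a

variable [IsProbabilityMeasure P]

theorem MixingBound.norm_setIntegral_sub_le (h₁ : m₁ ≤ mΩ) (h₂ : m₂ ≤ mΩ) {a : ℝ}
    (hmix : MixingBound m₁ m₂ P a) {f : Ω → ℂ} (hf : Measurable[m₁] f) (hf1 : ∀ ω, ‖f ω‖ ≤ 1)
    {B : Set Ω} (hB : MeasurableSet[m₂] B) :
    ‖∫ ω in B, (f ω - ∫ ω', f ω' ∂P) ∂P‖ ≤ 4 * a := by
  have hB' := h₂ B hB
  have hfi : Integrable f P :=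
    .of_bound (hf.mono h₁ le_rfl).aestronglyMeasurable 1 (ae_of_all _ hf1)
  have hind : Integrable (B.indicator fun _ => (1 : ℂ)) P := (integrable_const 1).indicator hB'
  have hw : Integrable (fun ω => B.indicator (fun _ => (1 : ℂ)) ω - P.real B) P :=
    hind.sub (integrable_const _)
  have hswap : ∫ ω in B, (f ω - ∫ ω', f ω' ∂P) ∂P =
      ∫ ω, f ω * (B.indicator (fun _ => (1 : ℂ)) ω - P.real B) ∂P := by
    have hmul : (fun ω => f ω * B.indicator (fun _ => (1 : ℂ)) ω) = B.indicator f := by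
      ext ω; by_cases h : ω ∈ B <;> simp [h]
    simp only [mul_sub]
    rw [integral_sub hfi.integrableOn (integrable_const _).integrableOn, integral_sub
      (hmul ▸ hfi.indicator hB') (hfi.mul_const _), hmul, integral_indicator hB',
      integral_mul_const, setIntegral_const, Complex.real_smul, mul_comm]
  rw [hswap]
  refine (norm_integral_mul_le_integral_norm_condExp h₁ hf hf1 hw).trans
    (integral_norm_condExp_le h₁ hw fun A hA => ?_)
  rw [integral_sub hind.integrableOn (integrable_const _).integrableOn, setIntegral_indicator hB',
    setIntegral_const, setIntegral_const, Complex.real_smul, Complex.real_smul, mul_one,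
    ← Complex.ofReal_mul, ← Complex.ofReal_sub, Complex.norm_real]
  exact hmix A B hA hB

theorem MixingBound.norm_cov_le (h₁ : m₁ ≤ mΩ) (h₂ : m₂ ≤ mΩ) {a : ℝ}
    (hmix : MixingBound m₁ m₂ P a) {f g : Ω → ℂ}
    (hf : Measurable[m₁] f) (hf1 : ∀ ω, ‖f ω‖ ≤ 1)
    (hg : Measurable[m₂] g) (hg1 : ∀ ω, ‖g ω‖ ≤ 1) :
    ‖∫ ω, f ω * g ω ∂P - (∫ ω, f ω ∂P) * ∫ ω, g ω ∂P‖ ≤ 16 * a := by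
  have hgm := (hg.mono h₂ le_rfl).aestronglyMeasurable (μ := P)
  have hfi : Integrable f P :=
    .of_bound (hf.mono h₁ le_rfl).aestronglyMeasurable 1 (ae_of_all _ hf1)
  have hgi : Integrable g P := .of_bound hgm 1 (ae_of_all _ hg1)
  have hw : Integrable (fun ω => f ω - ∫ ω', f ω' ∂P) P := hfi.sub (integrable_const _)
  have hcov : ∫ ω, f ω * g ω ∂P - (∫ ω, f ω ∂P) * ∫ ω, g ω ∂P =
      ∫ ω, g ω * (f ω - ∫ ω', f ω' ∂P) ∂P := by
    simp only [mul_sub]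
    rw [integral_sub (hfi.bdd_mul hgm (ae_of_all _ hg1)) (hgi.mul_const _), integral_mul_const,
      mul_comm (∫ ω, g ω ∂P)]
    simp only [mul_comm (g _)]
  calc ‖∫ ω, f ω * g ω ∂P - (∫ ω, f ω ∂P) * ∫ ω, g ω ∂P‖
      ≤ ∫ ω, ‖(P[fun ω => f ω - ∫ ω', f ω' ∂P | m₂]) ω‖ ∂P :=
        hcov ▸ norm_integral_mul_le_integral_norm_condExp h₂ hg hg1 hw
    _ ≤ 4 * (4 * a) := integral_norm_condExp_le h₂ hw fun _ hB =>
        hmix.norm_setIntegral_sub_le h₁ h₂ hf hf1 hB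
    _ = 16 * a := by ring

end CovarianceInequality

section AlphaCoeff

variable {Ω : Type*} [MeasurableSpace Ω] {P : Measure Ω} {d : ℕ}
  {X : ℤ → Ω → EuclideanSpace ℝ (Fin d)}

/-- The sigma-algebra generated by the process at the times in `T`. -/
abbrev sigmaAt (X : ℤ → Ω → EuclideanSpace ℝ (Fin d)) (T : Set ℤ) : MeasurableSpace Ω :=
  ⨆ t ∈ T, MeasurableSpace.comap (X t) inferInstance

theorem sigmaAt_le (hX : ∀ t, Measurable (X t)) (T : Set ℤ) :
    sigmaAt X T ≤ (inferInstance : MeasurableSpace Ω) :=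
  iSup₂_le fun t _ => (hX t).comap_le

omit [MeasurableSpace Ω] in
theorem measurable_sigmaAt {T : Set ℤ} {t : ℤ} (ht : t ∈ T) : Measurable[sigmaAt X T] (X t) :=
  Measurable.mono (comap_measurable (X t))
    (le_iSup₂_of_le (f := fun t (_ : t ∈ T) => MeasurableSpace.comap (X t) inferInstance)
      t ht le_rfl) le_rfl

variable [IsProbabilityMeasure P]

theorem mixingBound_alphaCoeff (s : ℤ) (h : ℕ) :
    MixingBound (sigmaAt X (Set.Iic s)) (sigmaAt X (Set.Ici (s + h))) P (alphaCoeff P X h) := by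
  intro A B hA hB
  refine le_csSup ⟨1, ?_⟩ ⟨s, A, B, hA, hB, rfl⟩
  rintro x ⟨s, A, B, -, -, rfl⟩
  exact abs_sub_le_of_nonneg_of_le measureReal_nonneg measureReal_le_one (by positivity)
    (mul_le_one₀ measureReal_le_one measureReal_nonneg measureReal_le_one)

theorem alphaCoeff_nonneg (h : ℕ) : 0 ≤ alphaCoeff P X h :=
  (abs_nonneg _).trans (mixingBound_alphaCoeff (X := X) (P := P) 0 h ∅ ∅
    (@MeasurableSet.empty _ (sigmaAt X _)) (@MeasurableSet.empty _ (sigmaAt X _)))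

end AlphaCoeff

section UniformTails

/-- The rows of the array `u` have tails that are eventually uniformly small in `ℓ¹`; this plays
the role of the dominating sequence in Tannery's theorem. -/
def UniformlySmallTails (u : ℕ → ℕ → ℝ) : Prop :=
  ∀ ε : ℝ, 0 < ε → ∃ k, ∀ᶠ n in atTop, ∀ N, ∑ h ∈ Finset.Ico k N, |u n h| ≤ ε

variable {u w : ℕ → ℕ → ℝ} {v : ℕ → ℝ}

theorem UniformlySmallTails.of_abs_le_mul (htail : UniformlySmallTails u) {b : ℝ} (hb : 0 < b)
    (hw : ∀ n h, |w n h| ≤ b * |u n h|) : UniformlySmallTails w := fun ε hε => by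
  obtain ⟨k, hk⟩ := htail (ε / b) (by positivity)
  refine ⟨k, hk.mono fun n hn N => (Finset.sum_le_sum fun h _ => hw n h).trans ?_⟩
  rw [← Finset.mul_sum, ← le_div_iff₀' hb]
  exact hn N

theorem sum_range_abs_le_add (x : ℕ → ℝ) (k N : ℕ) :
    ∑ h ∈ Finset.range N, |x h| ≤
      ∑ h ∈ Finset.range k, |x h| + ∑ h ∈ Finset.Ico k (max k N), |x h| := by
  rw [Finset.sum_range_add_sum_Ico _ (le_max_left _ _)]
  exact Finset.sum_le_sum_of_subset_of_nonneg (by simp) fun h _ _ => abs_nonneg _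

theorem sum_Ico_abs_le_of_tendsto (hlim : ∀ h, Tendsto (fun n => u n h) atTop (𝓝 (v h))) {k : ℕ}
    {ε : ℝ} (htail : ∀ᶠ n in atTop, ∀ N, ∑ h ∈ Finset.Ico k N, |u n h| ≤ ε) (N : ℕ) :
    ∑ h ∈ Finset.Ico k N, |v h| ≤ ε :=
  le_of_tendsto (tendsto_finsetSum _ fun h _ => (hlim h).abs) (htail.mono fun _ hn => hn N)

theorem UniformlySmallTails.summable (htail : UniformlySmallTails u)
    (hlim : ∀ h, Tendsto (fun n => u n h) atTop (𝓝 (v h))) : Summable v := by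
  obtain ⟨k, hk⟩ := htail 1 one_pos
  exact .of_abs (summable_of_sum_range_le (fun h => abs_nonneg _) fun N =>
    (sum_range_abs_le_add v k N).trans
      (add_le_add_right (sum_Ico_abs_le_of_tendsto hlim hk _) _))

theorem UniformlySmallTails.tendsto_sum_range (htail : UniformlySmallTails u)
    (hlim : ∀ h, Tendsto (fun n => u n h) atTop (𝓝 (v h)))
    {L : ℕ → ℕ} (hL : Tendsto L atTop atTop) :
    Tendsto (fun n => ∑ h ∈ Finset.range (L n), u n h) atTop (𝓝 (∑' h, v h)) := by
  rw [Metric.tendsto_nhds]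
  intro ε hε
  obtain ⟨k, hk⟩ := htail (ε / 4) (by positivity)
  have htail_v : |∑' h, v h - ∑ h ∈ Finset.range k, v h| ≤ ε / 4 := by
    refine le_of_tendsto
      (((htail.summable hlim).hasSum.tendsto_sum_nat.sub_const _).abs) ?_
    filter_upwards [eventually_ge_atTop k] with N hN
    rw [← Finset.sum_range_add_sum_Ico _ hN, add_sub_cancel_left]
    exact (Finset.abs_sum_le_sum_abs _ _).trans (sum_Ico_abs_le_of_tendsto hlim hk N)
  have hhead := Metric.tendsto_nhds.1 (tendsto_finsetSum (Finset.range k) fun h _ => hlim h)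
    (ε / 4) (by positivity)
  filter_upwards [hk, hhead, hL.eventually_ge_atTop k] with n htail_n hhead_n hLn
  have htail_u := (Finset.abs_sum_le_sum_abs (u n) (Finset.Ico k (L n))).trans (htail_n (L n))
  rw [Real.dist_eq] at hhead_n ⊢
  rw [← Finset.sum_range_add_sum_Ico _ hLn]
  rw [abs_le] at htail_v htail_u
  rw [abs_lt] at hhead_n ⊢
  constructor <;> linarith [htail_v.1, htail_v.2, htail_u.1, htail_u.2, hhead_n.1, hhead_n.2]

theorem UniformlySmallTails.exists_eventually_sum_range_le (htail : UniformlySmallTails u)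
    (hlim : ∀ h, Tendsto (fun n => u n h) atTop (𝓝 (v h))) :
    ∃ b : ℝ, ∀ᶠ n in atTop, ∀ N, ∑ h ∈ Finset.range N, |u n h| ≤ b := by
  obtain ⟨k, hk⟩ := htail 1 one_pos
  have hhead := (tendsto_finsetSum (Finset.range k) fun h _ => (hlim h).abs).eventually_le_const
    (lt_add_one _)
  refine ⟨∑ h ∈ Finset.range k, |v h| + 1 + 1, ?_⟩
  filter_upwards [hk, hhead] with n htail_n hhead_n N
  exact (sum_range_abs_le_add (u n) k N).trans (add_le_add hhead_n (htail_n _))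

end UniformTails

section DistSums

/-- The multiplicity of the lag `h` in a symmetric double sum: lag `0` counts once, every other lag
twice. -/
def lagWeight (h : ℕ) : ℝ := if h = 0 then 1 else 2

theorem lagWeight_nonneg (h : ℕ) : 0 ≤ lagWeight h := by
  unfold lagWeight; split_ifs <;> norm_num

theorem lagWeight_le_two (h : ℕ) : lagWeight h ≤ 2 := by
  unfold lagWeight; split_ifs <;> norm_num

theorem sum_sum_dist (g : ℕ → ℝ) (L : ℕ) :
    ∑ s ∈ Finset.range L, ∑ t ∈ Finset.range L, g (Nat.dist s t) =
      ∑ h ∈ Finset.range L, ((L : ℝ) - h) * (lagWeight h * g h) := by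
  induction L with
  | zero => simp
  | succ L ih =>
    have hlast : ∑ s ∈ Finset.range L, g (Nat.dist s L) = ∑ h ∈ Finset.range L, g (h + 1) := by
      rw [← Finset.sum_range_reflect (fun h => g (h + 1))]
      refine Finset.sum_congr rfl fun s hs => ?_
      have := Finset.mem_range.1 hs
      congr 1
      rw [Nat.dist_eq_sub_of_le this.le]
      omega
    have hweight : ∑ t ∈ Finset.range (L + 1), lagWeight t * g t =
        2 * ∑ h ∈ Finset.range L, g (h + 1) + g 0 := by
      rw [Finset.sum_range_succ', Finset.mul_sum]
      simp [lagWeight]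
    have hsucc : ∑ h ∈ Finset.range (L + 1), (((L + 1 : ℕ) : ℝ) - h) * (lagWeight h * g h) =
        ∑ h ∈ Finset.range (L + 1), ((L : ℝ) - h) * (lagWeight h * g h) +
          ∑ h ∈ Finset.range (L + 1), lagWeight h * g h := by
      rw [← Finset.sum_add_distrib]
      refine Finset.sum_congr rfl fun h _ => ?_
      push_cast
      ring
    rw [hsucc, hweight, Finset.sum_range_succ (fun h => ((L : ℝ) - h) * (lagWeight h * g h)),
      ← ih]
    simp only [Finset.sum_range_succ, Finset.sum_add_distrib]
    simp only [Nat.dist_comm L, hlast, Nat.dist_self]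
    ring

theorem sum_dist_le {g : ℕ → ℝ} (hg : ∀ h, 0 ≤ g h) {N s : ℕ} (hs : s < N) :
    ∑ t ∈ Finset.range N, g (Nat.dist s t) ≤ 2 * ∑ h ∈ Finset.range N, g h := by
  have hmaps : ∀ t ∈ Finset.range N, Nat.dist s t ∈ Finset.range N := fun t ht => by
    simp only [Finset.mem_range, Nat.dist] at *
    omega
  rw [← Finset.sum_fiberwise_of_maps_to hmaps, Finset.mul_sum]
  refine Finset.sum_le_sum fun h _ => ?_
  rw [Finset.sum_congr rfl fun t ht => by rw [(Finset.mem_filter.1 ht).2], Finset.sum_const,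
    nsmul_eq_mul]
  refine mul_le_mul_of_nonneg_right ?_ (hg h)
  have hfiber : (Finset.range N).filter (fun t => Nat.dist s t = h) ⊆ {s - h, s + h} :=
    fun t ht => by
      have := (Finset.mem_filter.1 ht).2
      simp only [Finset.mem_insert, Finset.mem_singleton, Nat.dist] at *
      omega
  exact_mod_cast (Finset.card_le_card hfiber).trans Finset.card_le_two

end DistSums

section CentredIndicators

variable {Ω : Type*} [MeasurableSpace Ω] {P : Measure Ω} {d : ℕ}
  {X : ℤ → Ω → EuclideanSpace ℝ (Fin d)} {D : Set (EuclideanSpace ℝ (Fin d))}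

/-- The indicator of the event `X t ∈ D`, centred at the probability of `X 0 ∈ D`. -/
noncomputable def centred (P : Measure Ω) (X : ℤ → Ω → EuclideanSpace ℝ (Fin d))
    (D : Set (EuclideanSpace ℝ (Fin d))) (t : ℤ) (ω : Ω) : ℝ :=
  (X t ⁻¹' D).indicator 1 ω - P.real (X 0 ⁻¹' D)

/-- The covariance at lag `h` of the indicators of `X t ∈ D`, for a stationary process. -/
noncomputable def lagCov (P : Measure Ω) (X : ℤ → Ω → EuclideanSpace ℝ (Fin d))
    (D : Set (EuclideanSpace ℝ (Fin d))) (h : ℕ) : ℝ :=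
  P.real (X 0 ⁻¹' D ∩ X h ⁻¹' D) - P.real (X 0 ⁻¹' D) ^ 2

theorem measurable_centred_sigmaAt (hD : MeasurableSet D) {T : Set ℤ} {t : ℤ} (ht : t ∈ T) :
    Measurable[sigmaAt X T] (centred P X D t) :=
  ((measurable_const.indicator hD).comp (measurable_sigmaAt ht)).sub_const _

theorem measurable_centred (hX : ∀ t, Measurable (X t)) (hD : MeasurableSet D) (t : ℤ) :
    Measurable (centred P X D t) :=
  (measurable_one.indicator (hX t hD)).sub_const _

theorem measurable_sum_centred (hX : ∀ t, Measurable (X t)) (hD : MeasurableSet D)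
    (T : Finset ℕ) : Measurable fun ω => ∑ t ∈ T, centred P X D t ω :=
  Finset.measurable_fun_sum _ fun t _ => measurable_centred hX hD t

theorem StrictlyStationary.measureReal_preimage (hstat : StrictlyStationary P X)
    (hD : MeasurableSet D) (t : ℤ) : P.real (X t ⁻¹' D) = P.real (X 0 ⁻¹' D) := by
  have := hstat.measureReal_eq t (S := {f | f 0 ∈ D}) (measurable_pi_apply 0 hD)
  simp only [Set.mem_ofPred_eq, zero_add] at this
  exact this

theorem StrictlyStationary.measureReal_preimage_inter (hstat : StrictlyStationary P X)
    (hD : MeasurableSet D) (s t : ℕ) :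
    P.real (X s ⁻¹' D ∩ X t ⁻¹' D) = P.real (X 0 ⁻¹' D ∩ X (Nat.dist s t) ⁻¹' D) := by
  wlog h : s ≤ t generalizing s t
  · rw [Set.inter_comm, Nat.dist_comm]
    exact this t s (le_of_not_ge h)
  have hshift := hstat.measureReal_eq s (S := {f | f 0 ∈ D} ∩ {f | f (Nat.dist s t : ℕ) ∈ D})
    ((measurable_pi_apply 0 hD).inter (measurable_pi_apply _ hD))
  have ht : ((Nat.dist s t : ℕ) : ℤ) + s = t := by
    rw [Nat.dist_eq_sub_of_le h]; push_cast [h]; ring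
  simp only [Set.mem_inter_iff, Set.mem_ofPred_eq, zero_add, ht] at hshift
  exact hshift

theorem abs_lagCov_le (h : ℕ) : |lagCov P X D h| ≤
    P.real (X 0 ⁻¹' D ∩ X h ⁻¹' D) + P.real (X 0 ⁻¹' D) ^ 2 := by
  refine (abs_sub _ _).trans_eq ?_
  rw [abs_of_nonneg measureReal_nonneg, abs_of_nonneg (sq_nonneg _)]

variable [IsProbabilityMeasure P]

theorem abs_lagCov_le_alphaCoeff (hstat : StrictlyStationary P X) (hD : MeasurableSet D) (h : ℕ) :
    |lagCov P X D h| ≤ alphaCoeff P X h := by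
  have := mixingBound_alphaCoeff (P := P) (X := X) 0 h (X 0 ⁻¹' D) (X h ⁻¹' D)
    (measurable_sigmaAt (by simp) hD) (measurable_sigmaAt (by simp) hD)
  rwa [hstat.measureReal_preimage hD h, ← sq] at this

theorem abs_centred_le (t : ℤ) (ω : Ω) : |centred P X D t ω| ≤ 1 :=
  abs_sub_le_of_nonneg_of_le (Set.indicator_nonneg (fun _ _ => zero_le_one) _)
    (Set.indicator_le_self' (fun _ _ => zero_le_one) _) measureReal_nonneg measureReal_le_one

theorem abs_sum_centred_le (T : Finset ℕ) (ω : Ω) : |∑ t ∈ T, centred P X D t ω| ≤ T.card := by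
  refine (Finset.abs_sum_le_sum_abs _ _).trans ?_
  refine (Finset.sum_le_card_nsmul _ _ 1 fun t _ => abs_centred_le _ ω).trans_eq ?_
  simp

theorem integrable_indicator_preimage (hX : ∀ t, Measurable (X t)) (hD : MeasurableSet D) (t : ℤ) :
    Integrable ((X t ⁻¹' D).indicator (1 : Ω → ℝ)) P :=
  (integrable_const (1 : ℝ)).indicator (hX t hD)

theorem integrable_centred (hX : ∀ t, Measurable (X t)) (hD : MeasurableSet D) (t : ℤ) :
    Integrable (centred P X D t) P :=
  (integrable_indicator_preimage hX hD t).sub (integrable_const _)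

theorem integral_centred (hX : ∀ t, Measurable (X t)) (hstat : StrictlyStationary P X)
    (hD : MeasurableSet D) (t : ℤ) : ∫ ω, centred P X D t ω ∂P = 0 := by
  unfold centred
  rw [integral_sub (integrable_indicator_preimage hX hD t) (integrable_const _),
    integral_indicator_one (hX t hD), hstat.measureReal_preimage hD t, integral_const]
  simp

theorem integral_sum_centred (hX : ∀ t, Measurable (X t)) (hstat : StrictlyStationary P X)
    (hD : MeasurableSet D) (T : Finset ℕ) : ∫ ω, ∑ t ∈ T, centred P X D t ω ∂P = 0 := by
  rw [integral_finsetSum T fun t _ => integrable_centred hX hD t]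
  exact Finset.sum_eq_zero fun t _ => integral_centred hX hstat hD t

theorem integrable_centred_mul (hX : ∀ t, Measurable (X t)) (hD : MeasurableSet D) (s t : ℤ) :
    Integrable (fun ω => centred P X D s ω * centred P X D t ω) P :=
  (integrable_centred hX hD t).bdd_mul (measurable_centred hX hD s).aestronglyMeasurable
    (ae_of_all _ (abs_centred_le s))

theorem integral_centred_mul (hX : ∀ t, Measurable (X t)) (hstat : StrictlyStationary P X)
    (hD : MeasurableSet D) (s t : ℕ) :
    ∫ ω, centred P X D s ω * centred P X D t ω ∂P = lagCov P X D (Nat.dist s t) := by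
  set p := P.real (X 0 ⁻¹' D)
  have hexpand : ∀ ω, centred P X D s ω * centred P X D t ω =
      (X s ⁻¹' D ∩ X t ⁻¹' D).indicator 1 ω -
        p * (centred P X D s ω + (X t ⁻¹' D).indicator 1 ω) := fun ω => by
    rw [Set.inter_indicator_one, Pi.mul_apply]
    unfold centred
    ring
  have hst := (hX s hD).inter (hX t hD)
  have hinter : Integrable ((X s ⁻¹' D ∩ X t ⁻¹' D).indicator (1 : Ω → ℝ)) P :=
    (integrable_const (1 : ℝ)).indicator hst
  have hs := integrable_centred (P := P) hX hD s
  have ht := integrable_indicator_preimage (P := P) hX hD t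
  have hp_mul : Integrable
      (fun ω => p * (centred P X D s ω + (X t ⁻¹' D).indicator 1 ω)) P := (hs.add ht).const_mul p
  simp only [hexpand]
  rw [integral_sub hinter hp_mul, integral_const_mul, integral_add hs ht,
    integral_indicator_one hst, integral_centred hX hstat hD, integral_indicator_one (hX t hD),
    hstat.measureReal_preimage hD t, hstat.measureReal_preimage_inter hD, lagCov]
  ring

theorem integral_sq_sum_centred (hX : ∀ t, Measurable (X t)) (hstat : StrictlyStationary P X)
    (hD : MeasurableSet D) (T : Finset ℕ) :
    ∫ ω, (∑ t ∈ T, centred P X D t ω) ^ 2 ∂P =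
      ∑ s ∈ T, ∑ t ∈ T, lagCov P X D (Nat.dist s t) := by
  simp only [sq, Finset.sum_mul_sum]
  rw [integral_finsetSum T fun s _ => integrable_finsetSum T fun t _ =>
    integrable_centred_mul (P := P) hX hD s t]
  refine Finset.sum_congr rfl fun s _ => ?_
  rw [integral_finsetSum T fun t _ => integrable_centred_mul (P := P) hX hD s t]
  exact Finset.sum_congr rfl fun t _ => integral_centred_mul hX hstat hD s t

theorem integral_sq_sum_centred_le (hX : ∀ t, Measurable (X t)) (hstat : StrictlyStationary P X)
    (hD : MeasurableSet D) {T : Finset ℕ} {N : ℕ} (hT : T ⊆ Finset.range N) :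
    ∫ ω, (∑ t ∈ T, centred P X D t ω) ^ 2 ∂P ≤
      T.card * (2 * ∑ h ∈ Finset.range N, |lagCov P X D h|) := by
  rw [integral_sq_sum_centred hX hstat hD, ← nsmul_eq_mul]
  refine Finset.sum_le_card_nsmul _ _ _ fun s hs => ?_
  calc ∑ t ∈ T, lagCov P X D (Nat.dist s t) ≤ ∑ t ∈ T, |lagCov P X D (Nat.dist s t)| :=
        Finset.sum_le_sum fun t _ => le_abs_self _
    _ ≤ ∑ t ∈ Finset.range N, |lagCov P X D (Nat.dist s t)| :=
        Finset.sum_le_sum_of_subset_of_nonneg hT fun _ _ _ => abs_nonneg _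
    _ ≤ _ := sum_dist_le (fun h => abs_nonneg _) (Finset.mem_range.1 (hT hs))

end CentredIndicators

section CharFunEstimates

theorem norm_exp_ofReal_mul_I_sub_le (x : ℝ) :
    ‖Complex.exp (x * Complex.I) - (1 + x * Complex.I - (x : ℂ) ^ 2 / 2)‖ ≤
      4 * (x ^ 2 * min |x| 1) := by
  have hnorm : ‖(x : ℂ) * Complex.I‖ = |x| := by simp
  rcases le_total |x| 1 with h | h
  · have htaylor := Complex.exp_bound (x := (x : ℂ) * Complex.I) (by rwa [hnorm]) (n := 3)
      (by norm_num)
    have hsum : ∑ k ∈ Finset.range 3, ((x : ℂ) * Complex.I) ^ k / (k.factorial : ℂ) =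
        1 + x * Complex.I - (x : ℂ) ^ 2 / 2 := by
      simp [Finset.sum_range_succ, mul_pow, Nat.factorial]
      ring
    rw [hsum, hnorm] at htaylor
    have hcube : |x| ^ 3 = x ^ 2 * |x| := by rw [pow_succ, sq_abs]
    rw [min_eq_left h, ← hcube]
    refine htaylor.trans ?_
    rw [mul_comm]
    gcongr
    norm_num [Nat.factorial]
  · have hsq : 1 ≤ |x| ^ 2 := one_le_pow₀ h
    have hquadratic : ‖1 + (x : ℂ) * Complex.I - (x : ℂ) ^ 2 / 2‖ ≤ 1 + |x| + |x| ^ 2 / 2 := by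
      refine (norm_sub_le _ _).trans (add_le_add ((norm_add_le _ _).trans ?_) ?_)
      · rw [norm_one, hnorm]
      · simp
    rw [min_eq_right h, mul_one, ← sq_abs x]
    refine (norm_sub_le _ _).trans ?_
    rw [Complex.norm_exp_ofReal_mul_I]
    nlinarith

theorem tendsto_one_add_pow_exp {g : ℕ → ℂ} {K : ℕ → ℕ} {z : ℂ} (hK : Tendsto K atTop atTop)
    (hg : Tendsto (fun n => (K n : ℂ) * g n) atTop (𝓝 z)) :
    Tendsto (fun n => (1 + g n) ^ K n) atTop (𝓝 (Complex.exp z)) := by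
  have hg0 : Tendsto g atTop (𝓝 0) := by
    have hmul := hg.mul ((tendsto_inv_atTop_nhds_zero_nat (𝕜 := ℂ)).comp hK)
    rw [mul_zero] at hmul
    refine hmul.congr' ?_
    filter_upwards [hK.eventually_ne_atTop 0] with n hn
    simp only [Function.comp_apply]
    field_simp
  have hlog : Tendsto (fun n => (K n : ℂ) * Complex.log (1 + g n)) atTop (𝓝 z) := by
    have hremainder : Tendsto (fun n => (K n : ℂ) * (Complex.log (1 + g n) - g n)) atTop
        (𝓝 0) := by
      refine ((Asymptotics.isBigO_refl (fun n => (K n : ℂ)) atTop).mul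
        (Complex.log_sub_self_isBigO.comp_tendsto hg0)).trans_tendsto ?_
      have hprod := hg.mul hg0
      rw [mul_zero] at hprod
      exact hprod.congr fun n => by simp only [Function.comp_apply]; ring
    simpa [mul_sub] using hremainder.add hg
  refine ((Complex.continuous_exp.tendsto _).comp hlog).congr' ?_
  filter_upwards [hg0.eventually_ne (show (0 : ℂ) ≠ -1 by simp)] with n hn
  have hne : 1 + g n ≠ 0 := fun h => hn (eq_neg_of_add_eq_zero_right h)
  rw [Function.comp_apply, Complex.exp_nat_mul, Complex.exp_log hne]

variable {Ω : Type*} [MeasurableSpace Ω] {P : Measure Ω} [IsProbabilityMeasure P]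

theorem integrable_exp_ofReal_mul_I {Z : Ω → ℝ} (hZ : AEStronglyMeasurable Z P) :
    Integrable (fun ω => Complex.exp (Z ω * Complex.I)) P :=
  .of_bound (by fun_prop) 1 (ae_of_all _ fun ω => (Complex.norm_exp_ofReal_mul_I _).le)

theorem integral_quadratic_taylor {Z : Ω → ℝ} (hZ : MemLp Z 2 P) (h0 : ∫ ω, Z ω ∂P = 0) :
    Integrable (fun ω => 1 + (Z ω : ℂ) * Complex.I - (Z ω : ℂ) ^ 2 / 2) P ∧
      ∫ ω, (1 + (Z ω : ℂ) * Complex.I - (Z ω : ℂ) ^ 2 / 2) ∂P =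
        1 - ((∫ ω, Z ω ^ 2 ∂P : ℝ) : ℂ) / 2 := by
  have hmul : Integrable (fun ω => (Z ω : ℂ) * Complex.I) P :=
    (hZ.integrable one_le_two).ofReal.mul_const Complex.I
  have hlin : Integrable (fun ω => 1 + (Z ω : ℂ) * Complex.I) P :=
    (integrable_const 1).add hmul
  have hsq : Integrable (fun ω => (Z ω : ℂ) ^ 2 / 2) P := by
    simpa using (hZ.integrable_sq.ofReal (𝕜 := ℂ)).div_const 2
  refine ⟨hlin.sub hsq, ?_⟩
  rw [integral_sub hlin hsq, integral_add (integrable_const 1) hmul, integral_mul_const,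
    integral_div, integral_complex_ofReal, h0, ← integral_complex_ofReal]
  simp

theorem norm_integral_exp_sub_le {Z : Ω → ℝ} (hZ : MemLp Z 2 P) (h0 : ∫ ω, Z ω ∂P = 0) {δ : ℝ}
    (hδ : 0 ≤ δ) :
    ‖∫ ω, Complex.exp (Z ω * Complex.I) ∂P - (1 - ((∫ ω, Z ω ^ 2 ∂P : ℝ) : ℂ) / 2)‖ ≤
      4 * (δ * ∫ ω, Z ω ^ 2 ∂P + ∫ ω in {ω | δ < |Z ω|}, Z ω ^ 2 ∂P) := by
  obtain ⟨htaylor, htaylor_eq⟩ := integral_quadratic_taylor hZ h0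
  have hset : NullMeasurableSet {ω | δ < |Z ω|} P :=
    nullMeasurableSet_lt aemeasurable_const hZ.aestronglyMeasurable.aemeasurable.abs
  have hsq := hZ.integrable_sq
  have htail : Integrable ({ω | δ < |Z ω|}.indicator fun ω => Z ω ^ 2) P := hsq.indicator₀ hset
  rw [← htaylor_eq,
    ← integral_sub (integrable_exp_ofReal_mul_I hZ.aestronglyMeasurable) htaylor,
    ← integral_indicator₀ hset, ← integral_const_mul, ← integral_add (hsq.const_mul δ) htail,
    ← integral_const_mul]
  refine norm_integral_le_of_norm_le (((hsq.const_mul δ).add htail).const_mul 4)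
    (ae_of_all _ fun ω => (norm_exp_ofReal_mul_I_sub_le _).trans ?_)
  gcongr
  by_cases hω : δ < |Z ω|
  · rw [Set.indicator_of_mem (by exact hω)]
    nlinarith [mul_le_mul_of_nonneg_left (min_le_right |Z ω| 1) (sq_nonneg (Z ω)),
      mul_nonneg hδ (sq_nonneg (Z ω))]
  · rw [Set.indicator_of_notMem (by exact hω), add_zero, mul_comm δ]
    exact mul_le_mul_of_nonneg_left ((min_le_left _ _).trans (not_lt.1 hω)) (sq_nonneg _)

theorem integral_abs_le_sqrt_integral_sq {R : Ω → ℝ} (hR : MemLp R 2 P) :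
    ∫ ω, |R ω| ∂P ≤ √(∫ ω, R ω ^ 2 ∂P) := by
  refine Real.le_sqrt_of_sq_le ?_
  have habs : MemLp (fun ω => |R ω|) 2 P := hR.abs
  have hvar := variance_nonneg (fun ω => |R ω|) P
  rw [variance_eq_sub habs] at hvar
  simpa [sq_abs] using hvar

theorem norm_integral_exp_sub_integral_exp_le {S T : Ω → ℝ} (hS : AEStronglyMeasurable S P)
    (hT : AEStronglyMeasurable T P) (hST : MemLp (fun ω => S ω - T ω) 2 P) :
    ‖∫ ω, Complex.exp (S ω * Complex.I) ∂P - ∫ ω, Complex.exp (T ω * Complex.I) ∂P‖ ≤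
      √(∫ ω, (S ω - T ω) ^ 2 ∂P) := by
  rw [← integral_sub (integrable_exp_ofReal_mul_I hS) (integrable_exp_ofReal_mul_I hT)]
  refine (norm_integral_le_of_norm_le (hST.integrable one_le_two).abs
    (ae_of_all _ fun ω => ?_)).trans (integral_abs_le_sqrt_integral_sq hST)
  have hfactor : Complex.exp (S ω * Complex.I) - Complex.exp (T ω * Complex.I) =
      Complex.exp (T ω * Complex.I) *
        (Complex.exp (Complex.I * ((S ω - T ω : ℝ) : ℂ)) - 1) := by
    rw [mul_sub, ← Complex.exp_add, mul_one]
    congr 2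
    push_cast
    ring
  rw [hfactor, norm_mul, Complex.norm_exp_ofReal_mul_I, one_mul]
  exact Real.norm_exp_I_mul_ofReal_sub_one_le

theorem tendsto_zero_of_forall_eventually_le_mul {b x : ℕ → ℝ} {s : ℝ} (hb : ∀ n, 0 ≤ b n)
    (hx : Tendsto x atTop (𝓝 s)) (h : ∀ δ : ℝ, 0 < δ → ∀ᶠ n in atTop, b n ≤ δ * (x n + 1)) :
    Tendsto b atTop (𝓝 0) := by
  rw [Metric.tendsto_nhds]
  intro ε hε
  have hδ : 0 < ε / (2 * (|s| + 2)) := by positivity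
  filter_upwards [h _ hδ, hx.eventually_lt_const (lt_add_one s)] with n hn hxn
  rw [Real.dist_eq, sub_zero, abs_of_nonneg (hb n)]
  calc b n ≤ ε / (2 * (|s| + 2)) * (|s| + 2) :=
        hn.trans (mul_le_mul_of_nonneg_left (by linarith [le_abs_self s]) hδ.le)
    _ < ε := by field_simp; norm_num

theorem tendsto_integral_exp_pow_of_lindeberg {Z : ℕ → Ω → ℝ} {K : ℕ → ℕ} {s : ℝ}
    (hZ : ∀ n, MemLp (Z n) 2 P) (h0 : ∀ n, ∫ ω, Z n ω ∂P = 0) (hK : Tendsto K atTop atTop)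
    (hvar : Tendsto (fun n => (K n : ℝ) * ∫ ω, Z n ω ^ 2 ∂P) atTop (𝓝 s))
    (hlindeberg : ∀ δ : ℝ, 0 < δ →
      Tendsto (fun n => (K n : ℝ) * ∫ ω in {ω | δ < |Z n ω|}, Z n ω ^ 2 ∂P) atTop (𝓝 0)) :
    Tendsto (fun n => (∫ ω, Complex.exp (Z n ω * Complex.I) ∂P) ^ K n) atTop
      (𝓝 (Complex.exp (-(s / 2 : ℝ)))) := by
  set φ : ℕ → ℂ := fun n => ∫ ω, Complex.exp (Z n ω * Complex.I) ∂P
  set v : ℕ → ℝ := fun n => ∫ ω, Z n ω ^ 2 ∂P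
  have herr : Tendsto (fun n => (K n : ℝ) * ‖φ n - (1 - (v n : ℂ) / 2)‖) atTop (𝓝 0) := by
    refine tendsto_zero_of_forall_eventually_le_mul (fun n => by positivity) (hvar.const_mul 4)
      fun δ hδ => ?_
    filter_upwards [(hlindeberg δ hδ).eventually_le_const (show 0 < δ / 4 by positivity)]
      with n hn
    have hle := mul_le_mul_of_nonneg_left (norm_integral_exp_sub_le (hZ n) (h0 n) hδ.le)
      (Nat.cast_nonneg (K n))
    linarith
  have hmain : Tendsto (fun n => (K n : ℂ) * (φ n - 1)) atTop (𝓝 (-(s / 2 : ℝ))) := by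
    have herr' : Tendsto (fun n => (K n : ℂ) * (φ n - (1 - (v n : ℂ) / 2))) atTop (𝓝 0) :=
      squeeze_zero_norm (fun n => by rw [norm_mul, Complex.norm_natCast]) herr
    have hvar' := ((Complex.continuous_ofReal.tendsto _).comp (hvar.div_const 2)).neg
    have hadd := herr'.add hvar'
    rw [zero_add] at hadd
    refine hadd.congr fun n => ?_
    simp only [Function.comp_apply]
    push_cast
    ring
  simpa only [add_sub_cancel] using tendsto_one_add_pow_exp hK hmain

end CharFunEstimates

section Blocking

theorem exists_intermediate_length {m : ℕ → ℕ} {x : ℕ → ℝ} (hm : Tendsto m atTop atTop)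
    (hx : Tendsto x atTop (𝓝 0)) (hx0 : ∀ n, 0 ≤ x n) :
    ∃ L : ℕ → ℕ, Tendsto L atTop atTop ∧ Tendsto (fun n => (L n : ℝ) / m n) atTop (𝓝 0) ∧
      Tendsto (fun n => x n * (m n / L n)) atTop (𝓝 0) := by
  have hm' : Tendsto (fun n => (m n : ℝ)) atTop atTop := tendsto_natCast_atTop_atTop.comp hm
  have hinv : Tendsto (fun n => (m n : ℝ)⁻¹) atTop (𝓝 0) := tendsto_inv_atTop_zero.comp hm'
  -- the geometric mean of the scales `x * m` and `m`
  set s : ℕ → ℝ := fun n => √(x n + (m n : ℝ)⁻¹)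
  have hs : Tendsto s atTop (𝓝 0) := by
    simpa [Function.comp_def] using (Real.continuous_sqrt.tendsto _).comp (hx.add hinv)
  have hsm : ∀ᶠ n in atTop, √(m n) ≤ s n * m n ∧ x n * m n ≤ s n * (s n * m n) := by
    filter_upwards [hm'.eventually_gt_atTop 0] with n hn
    have hsq : s n * s n = x n + (m n : ℝ)⁻¹ :=
      Real.mul_self_sqrt (add_nonneg (hx0 n) (by positivity))
    refine ⟨Real.sqrt_le_iff.2 ⟨by positivity, ?_⟩, ?_⟩
    · have : (s n * m n) ^ 2 = x n * m n ^ 2 + m n := by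
        rw [mul_pow, sq (s n), hsq]
        field_simp
      nlinarith [mul_nonneg (hx0 n) (sq_nonneg (m n : ℝ))]
    · rw [← mul_assoc, hsq]
      gcongr
      exact le_add_of_nonneg_right (by positivity)
  refine ⟨fun n => ⌈s n * m n⌉₊, tendsto_nat_ceil_atTop.comp
    (tendsto_atTop_mono' _ (hsm.mono fun n hn => hn.1) (Real.tendsto_sqrt_atTop.comp hm')), ?_, ?_⟩
  · refine squeeze_zero' (.of_forall fun n => by positivity) ?_ (by simpa using hs.add hinv)
    filter_upwards [hm'.eventually_gt_atTop 0] with n hn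
    rw [div_le_iff₀ hn, add_mul, inv_mul_cancel₀ hn.ne']
    exact (Nat.ceil_lt_add_one (by positivity)).le
  · refine squeeze_zero' (.of_forall fun n => mul_nonneg (hx0 n) (by positivity)) ?_ hs
    filter_upwards [hsm, hm'.eventually_gt_atTop 0] with n hn hmn
    have hpos : 0 < s n * m n := (Real.sqrt_pos.2 hmn).trans_le hn.1
    have hceil := Nat.le_ceil (s n * m n)
    rw [mul_div_assoc', div_le_iff₀ (hpos.trans_le hceil)]
    exact hn.2.trans (mul_le_mul_of_nonneg_left hceil (Real.sqrt_nonneg _))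

/-- A Bernstein blocking scheme: `K n` blocks of length `L n`, separated by gaps of length `r n`,
exhaust almost all of `{1, …, n}`. The blocks are short compared with `m n`, and replacing them by
independent copies at a cost `a n` per block is asymptotically free. -/
structure BlockScheme (m r : ℕ → ℕ) (a : ℕ → ℝ) (L K : ℕ → ℕ) : Prop where
  length_tendsto : Tendsto L atTop atTop
  count_tendsto : Tendsto K atTop atTop
  length_div : Tendsto (fun n => (L n : ℝ) / m n) atTop (𝓝 0)
  exhausts : Tendsto (fun n : ℕ => (K n : ℝ) * L n / n) atTop (𝓝 1)
  cost : Tendsto (fun n => K n * a n) atTop (𝓝 0)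
  fits : ∀ n, K n * (L n + r n) ≤ n

theorem exists_blockLength {m r : ℕ → ℕ} {a : ℕ → ℝ} (hm : Tendsto m atTop atTop)
    (hrm : Tendsto (fun n => (r n : ℝ) / m n) atTop (𝓝 0)) (ha : ∀ n, 0 ≤ a n)
    (hma : Tendsto (fun n : ℕ => (n : ℝ) / m n * a n) atTop (𝓝 0)) :
    ∃ L : ℕ → ℕ, Tendsto L atTop atTop ∧ Tendsto (fun n => (L n : ℝ) / m n) atTop (𝓝 0) ∧
      Tendsto (fun n => (r n : ℝ) / L n) atTop (𝓝 0) ∧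
      Tendsto (fun n : ℕ => (n : ℝ) / L n * a n) atTop (𝓝 0) := by
  have hx := hrm.add hma
  rw [add_zero] at hx
  have hcost : ∀ n : ℕ, 0 ≤ (n : ℝ) / m n * a n := fun n => mul_nonneg (by positivity) (ha n)
  obtain ⟨L, hL, hLm, hxL⟩ := exists_intermediate_length hm hx fun n =>
    add_nonneg (by positivity) (hcost n)
  refine ⟨L, hL, hLm, squeeze_zero' (.of_forall fun n => by positivity) ?_ hxL,
    squeeze_zero' (.of_forall fun n => mul_nonneg (by positivity) (ha n)) ?_ hxL⟩
  · filter_upwards [hm.eventually_ne_atTop 0] with n hn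
    rw [← div_mul_div_cancel₀ (Nat.cast_ne_zero.2 hn)]
    gcongr
    exact le_add_of_nonneg_right (hcost n)
  · filter_upwards [hm.eventually_ne_atTop 0] with n hn
    rw [← div_mul_div_cancel₀ (Nat.cast_ne_zero.2 hn), mul_right_comm]
    gcongr
    exact le_add_of_nonneg_left (by positivity)

theorem tendsto_div_add_gap_atTop {m r L : ℕ → ℕ} (hm : Tendsto m atTop atTop)
    (hmn : Tendsto (fun n : ℕ => (m n : ℝ) / n) atTop (𝓝 0))
    (hrm : Tendsto (fun n => (r n : ℝ) / m n) atTop (𝓝 0)) (hL : Tendsto L atTop atTop)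
    (hLm : Tendsto (fun n => (L n : ℝ) / m n) atTop (𝓝 0)) :
    Tendsto (fun n : ℕ => (n : ℝ) / (L n + r n : ℕ)) atTop atTop := by
  have hzero : Tendsto (fun n : ℕ => ((L n + r n : ℕ) : ℝ) / n) atTop (𝓝 0) := by
    have := (hLm.add hrm).mul hmn
    rw [add_zero, mul_zero] at this
    refine this.congr' ?_
    filter_upwards [hm.eventually_ne_atTop 0] with n hn
    rw [← add_div, div_mul_div_cancel₀ (Nat.cast_ne_zero.2 hn), Nat.cast_add]
  have hpos : ∀ᶠ n : ℕ in atTop, ((L n + r n : ℕ) : ℝ) / n ∈ Set.Ioi 0 := by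
    filter_upwards [hL.eventually_gt_atTop 0, eventually_gt_atTop 0] with n hLn hn
    have : 0 < L n + r n := Nat.add_pos_left hLn _
    rw [Set.mem_Ioi]
    positivity
  refine (tendsto_nhdsWithin_iff.2 ⟨hzero, hpos⟩).inv_tendsto_nhdsGT_zero.congr fun n => ?_
  exact inv_div _ _

theorem exists_blockScheme {m r : ℕ → ℕ} {a : ℕ → ℝ} (hm : Tendsto m atTop atTop)
    (hmn : Tendsto (fun n : ℕ => (m n : ℝ) / n) atTop (𝓝 0))
    (hrm : Tendsto (fun n => (r n : ℝ) / m n) atTop (𝓝 0)) (ha : ∀ n, 0 ≤ a n)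
    (hma : Tendsto (fun n : ℕ => (n : ℝ) / m n * a n) atTop (𝓝 0)) :
    ∃ L K : ℕ → ℕ, BlockScheme m r a L K := by
  obtain ⟨L, hL, hLm, hrL, hLa⟩ := exists_blockLength hm hrm ha hma
  have hL0 : ∀ᶠ n in atTop, (0 : ℝ) < L n := by
    filter_upwards [hL.eventually_gt_atTop 0] with n hn using by exact_mod_cast hn
  have hratio := tendsto_div_add_gap_atTop hm hmn hrm hL hLm
  have hfloor : ∀ n : ℕ, ⌊(n : ℝ) / (L n + r n : ℕ)⌋₊ = n / (L n + r n) := fun n =>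
    Nat.floor_div_eq_div n (L n + r n)
  refine ⟨L, fun n => n / (L n + r n), hL, (tendsto_nat_floor_atTop.comp hratio).congr hfloor,
    hLm, ?_, ?_, fun n => Nat.div_mul_le_self n _⟩
  · have hgap := (hrL.const_add 1).inv₀ (by simp)
    have hexhausts := (tendsto_nat_floor_div_atTop.comp hratio).mul hgap
    rw [add_zero, inv_one, mul_one] at hexhausts
    refine hexhausts.congr' ?_
    filter_upwards [hL0, eventually_gt_atTop 0] with n hLn hn
    have hn' : (n : ℝ) ≠ 0 := by positivity
    have hsum : (L n : ℝ) + r n ≠ 0 := by positivity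
    rw [Function.comp_apply, hfloor, Nat.cast_add]
    field_simp
  · refine squeeze_zero' (.of_forall fun n => mul_nonneg (Nat.cast_nonneg _) (ha n)) ?_ hLa
    filter_upwards [hL0] with n hn
    refine mul_le_mul_of_nonneg_right (Nat.cast_div_le.trans ?_) (ha n)
    gcongr
    omega

theorem exists_blocks_remainder {n L r K : ℕ} (hK : K * (L + r) ≤ n) :
    ∃ T ⊆ Finset.range (n + 1), T.card = n - K * L ∧ ∀ y : ℕ → ℝ,
      ∑ t ∈ Finset.Icc 1 n, y t -
        ∑ j ∈ Finset.range K, ∑ i ∈ Finset.range L, y (j * (L + r) + 1 + i) = ∑ t ∈ T, y t := by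
  set block : ℕ → Finset ℕ := fun j =>
    Finset.Ico (j * (L + r) + 1) (j * (L + r) + 1 + L) with hblock
  have hdisj : (Finset.range K : Set ℕ).PairwiseDisjoint block := by
    intro i _ j _ hij
    wlog hlt : i < j generalizing i j
    · exact (this ‹_› ‹_› hij.symm (by omega)).symm
    refine Finset.disjoint_left.2 fun t hi hj => ?_
    have := Nat.mul_le_mul_right (L + r) hlt
    rw [Nat.succ_mul] at this
    simp only [hblock, Finset.mem_Ico] at hi hj
    omega
  have hsub : (Finset.range K).biUnion block ⊆ Finset.Icc 1 n := by
    refine Finset.biUnion_subset.2 fun j hj t ht => ?_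
    have := Nat.mul_le_mul_right (L + r) (Finset.mem_range.1 hj)
    rw [Nat.succ_mul] at this
    simp only [hblock, Finset.mem_Ico] at ht
    exact Finset.mem_Icc.2 (by omega)
  refine ⟨Finset.Icc 1 n \ (Finset.range K).biUnion block, fun t ht => ?_, ?_, fun y => ?_⟩
  · have := Finset.mem_Icc.1 (Finset.mem_sdiff.1 ht).1
    exact Finset.mem_range.2 (by omega)
  · rw [Finset.card_sdiff_of_subset hsub, Finset.card_biUnion hdisj]
    simp [hblock]
  · rw [← Finset.sum_sdiff hsub, Finset.sum_biUnion hdisj]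
    simp [hblock, Finset.sum_Ico_eq_sum_range]

end Blocking

section BlockDecoupling

theorem measurable_exp_mul_sum {Ω : Type*} {_ : MeasurableSpace Ω} {Y : ℕ → Ω → ℝ} {T : Finset ℕ}
    (hY : ∀ i ∈ T, Measurable (Y i)) (c : ℝ) :
    Measurable fun ω => Complex.exp ((c * ∑ i ∈ T, Y i ω : ℝ) * Complex.I) :=
  Complex.measurable_exp.comp ((Complex.measurable_ofReal.comp
    ((Finset.measurable_fun_sum T hY).const_mul c)).mul_const _)

variable {Ω : Type*} [MeasurableSpace Ω] {P : Measure Ω} {d : ℕ}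
  {X : ℤ → Ω → EuclideanSpace ℝ (Fin d)} {D : Set (EuclideanSpace ℝ (Fin d))}

theorem integral_exp_sum_centred_shift (hstat : StrictlyStationary P X) (hD : MeasurableSet D)
    (c : ℝ) (L k : ℕ) :
    ∫ ω, Complex.exp ((c * ∑ i ∈ Finset.range L, centred P X D (k + i : ℕ) ω : ℝ) *
        Complex.I) ∂P =
      ∫ ω, Complex.exp ((c * ∑ i ∈ Finset.range L, centred P X D i ω : ℝ) * Complex.I) ∂P := by
  have hf : Measurable fun x : ℤ → EuclideanSpace ℝ (Fin d) =>
      Complex.exp ((c * ∑ i ∈ Finset.range L, (D.indicator (fun _ => (1 : ℝ)) (x i) -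
        P.real (X 0 ⁻¹' D)) : ℝ) * Complex.I) :=
    measurable_exp_mul_sum (fun i _ =>
      ((measurable_const.indicator hD).comp (measurable_pi_apply (i : ℤ))).sub_const _) c
  simp only [add_comm k, Nat.cast_add]
  exact hstat.integral_eq (k : ℤ) hf

variable [IsProbabilityMeasure P]

theorem norm_integral_prod_sub_pow_le (hX : ∀ t, Measurable (X t)) {g : ℕ → Ω → ℂ} {φ : ℂ}
    {ℓ r : ℕ} (hg : ∀ j ω, ‖g j ω‖ ≤ 1)
    (hpast : ∀ j : ℕ, Measurable[sigmaAt X (Set.Iic (((j : ℤ) + 1) * ℓ + 1 - r))] (g j))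
    (hfuture : ∀ j : ℕ, Measurable[sigmaAt X (Set.Ici ((j : ℤ) * ℓ + 1))] (g j))
    (hφ : ∀ j, ∫ ω, g j ω ∂P = φ) (K : ℕ) :
    ‖∫ ω, ∏ j ∈ Finset.range K, g j ω ∂P - φ ^ K‖ ≤ K * (16 * alphaCoeff P X r) := by
  have hφ1 : ‖φ‖ ≤ 1 := by
    rw [← hφ 0]
    exact (norm_integral_le_of_norm_le_const (ae_of_all _ (hg 0))).trans (by simp)
  induction K with
  | zero => simp
  | succ K ih =>
    have hprod : Measurable[sigmaAt X (Set.Iic ((K : ℤ) * ℓ + 1 - r))]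
        fun ω => ∏ j ∈ Finset.range K, g j ω := by
      refine Finset.measurable_fun_prod _ fun j hj => (hpast j).mono
        (biSup_mono fun t (ht : t ≤ _) => ht.trans ?_) le_rfl
      have : ((j : ℤ) + 1) * ℓ ≤ K * ℓ :=
        mul_le_mul_of_nonneg_right (by exact_mod_cast Finset.mem_range.1 hj) (Nat.cast_nonneg _)
      linarith
    have hcov := (mixingBound_alphaCoeff (P := P) (X := X) ((K : ℤ) * ℓ + 1 - r) r).norm_cov_le
      (sigmaAt_le hX _) (sigmaAt_le hX _) hprod
      (fun ω => (norm_prod _ _).trans_le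
        (Finset.prod_le_one (fun _ _ => norm_nonneg _) fun j _ => hg j ω))
      (by rw [sub_add_cancel]; exact hfuture K) (hg K)
    rw [hφ K] at hcov
    have hsplit : ∫ ω, (∏ j ∈ Finset.range K, g j ω) * g K ω ∂P - φ ^ (K + 1) =
        (∫ ω, (∏ j ∈ Finset.range K, g j ω) * g K ω ∂P -
          (∫ ω, ∏ j ∈ Finset.range K, g j ω ∂P) * φ) +
        (∫ ω, ∏ j ∈ Finset.range K, g j ω ∂P - φ ^ K) * φ := by ring
    simp only [Finset.prod_range_succ]
    rw [hsplit]
    refine (norm_add_le _ _).trans ((add_le_add hcov ((norm_mul _ _).trans_le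
      ((mul_le_of_le_one_right (norm_nonneg _) hφ1).trans ih))).trans_eq ?_)
    push_cast
    ring

theorem norm_integral_exp_blocks_sub_pow_le (hX : ∀ t, Measurable (X t))
    (hstat : StrictlyStationary P X) (hD : MeasurableSet D) (c : ℝ) (L r K : ℕ) :
    ‖∫ ω, Complex.exp ((c * ∑ j ∈ Finset.range K, ∑ i ∈ Finset.range L,
          centred P X D (j * (L + r) + 1 + i : ℕ) ω : ℝ) * Complex.I) ∂P -
        (∫ ω, Complex.exp ((c * ∑ i ∈ Finset.range L, centred P X D i ω : ℝ) *
          Complex.I) ∂P) ^ K‖ ≤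
      K * (16 * alphaCoeff P X r) := by
  set g : ℕ → Ω → ℂ := fun j ω => Complex.exp ((c * ∑ i ∈ Finset.range L,
    centred P X D (j * (L + r) + 1 + i : ℕ) ω : ℝ) * Complex.I)
  have hprod : ∀ ω, Complex.exp ((c * ∑ j ∈ Finset.range K, ∑ i ∈ Finset.range L,
      centred P X D (j * (L + r) + 1 + i : ℕ) ω : ℝ) * Complex.I) =
      ∏ j ∈ Finset.range K, g j ω := fun ω => by
    rw [← Complex.exp_sum, ← Finset.sum_mul, ← Complex.ofReal_sum, ← Finset.mul_sum]
  have hpast : ∀ j : ℕ, Measurable[sigmaAt X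
      (Set.Iic (((j : ℤ) + 1) * (L + r : ℕ) + 1 - r))] (g j) := fun j =>
    measurable_exp_mul_sum (fun i hi => measurable_centred_sigmaAt hD (by
      have := Finset.mem_range.1 hi
      rw [Set.mem_Iic]
      push_cast
      linarith)) c
  have hfuture : ∀ j : ℕ, Measurable[sigmaAt X (Set.Ici ((j : ℤ) * (L + r : ℕ) + 1))] (g j) :=
    fun j => measurable_exp_mul_sum (fun i _ => measurable_centred_sigmaAt hD (by
      rw [Set.mem_Ici]
      push_cast
      linarith)) c
  simp only [hprod]
  exact norm_integral_prod_sub_pow_le hX (fun j ω => (Complex.norm_exp_ofReal_mul_I _).le)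
    hpast hfuture (fun j => integral_exp_sum_centred_shift hstat hD c L (j * (L + r) + 1)) K

theorem norm_integral_exp_sub_blocks_le (hX : ∀ t, Measurable (X t))
    (hstat : StrictlyStationary P X) (hD : MeasurableSet D) (c : ℝ) {n L r K : ℕ}
    (hK : K * (L + r) ≤ n) :
    ‖∫ ω, Complex.exp ((c * ∑ t ∈ Finset.Icc 1 n, centred P X D t ω : ℝ) * Complex.I) ∂P -
        ∫ ω, Complex.exp ((c * ∑ j ∈ Finset.range K, ∑ i ∈ Finset.range L,
          centred P X D (j * (L + r) + 1 + i : ℕ) ω : ℝ) * Complex.I) ∂P‖ ≤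
      √(c ^ 2 * ((n - K * L : ℕ) * (2 * ∑ h ∈ Finset.range (n + 1), |lagCov P X D h|))) := by
  obtain ⟨T, hT, hcard, hremainder⟩ := exists_blocks_remainder hK
  have hblocks : Measurable fun ω => c * ∑ j ∈ Finset.range K, ∑ i ∈ Finset.range L,
      centred P X D (j * (L + r) + 1 + i : ℕ) ω :=
    (Finset.measurable_fun_sum _ fun j _ => Finset.measurable_fun_sum _ fun i _ =>
      measurable_centred hX hD _).const_mul c
  have hdiff : ∀ ω, c * ∑ t ∈ Finset.Icc 1 n, centred P X D t ω -
      c * ∑ j ∈ Finset.range K, ∑ i ∈ Finset.range L,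
        centred P X D (j * (L + r) + 1 + i : ℕ) ω = c * ∑ t ∈ T, centred P X D t ω := fun ω => by
    rw [← mul_sub, hremainder fun t => centred P X D t ω]
  have hmem : MemLp (fun ω => c * ∑ t ∈ T, centred P X D t ω) 2 P :=
    (MemLp.of_bound (measurable_sum_centred hX hD T).aestronglyMeasurable T.card
      (ae_of_all _ (abs_sum_centred_le T))).const_mul c
  refine (norm_integral_exp_sub_integral_exp_le
    ((measurable_sum_centred hX hD _).const_mul c).aestronglyMeasurable
    hblocks.aestronglyMeasurable (by simpa only [hdiff] using hmem)).trans (Real.sqrt_le_sqrt ?_)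
  simp only [hdiff, mul_pow]
  rw [integral_const_mul, ← hcard]
  exact mul_le_mul_of_nonneg_left (integral_sq_sum_centred_le hX hstat hD hT) (sq_nonneg c)

end BlockDecoupling

section Lindeberg

variable {Ω : Type*} [MeasurableSpace Ω] {P : Measure Ω} {d : ℕ}
  {X : ℤ → Ω → EuclideanSpace ℝ (Fin d)} {D : Set (EuclideanSpace ℝ (Fin d))}

theorem sum_dist_lt_le {i L : ℕ} (hi : i < L) (k : ℕ) :
    ∑ j ∈ Finset.range L, (if Nat.dist i j < k then (1 : ℝ) else 0) ≤ 2 * k := by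
  refine (sum_dist_le (g := fun h => if h < k then (1 : ℝ) else 0)
    (fun h => by split_ifs <;> norm_num) hi).trans ?_
  rw [Finset.sum_boole]
  gcongr
  refine (Finset.card_le_card (t := Finset.range k) fun h hh => ?_).trans_eq (Finset.card_range k)
  exact Finset.mem_range.2 (Finset.mem_filter.1 hh).2

theorem sq_sum_le_add_sum_dist {x : ℕ → ℝ} (h0 : ∀ i, 0 ≤ x i) (h1 : ∀ i, x i ≤ 1) (k L : ℕ) :
    (∑ i ∈ Finset.range L, x i) ^ 2 ≤ 2 * k * ∑ i ∈ Finset.range L, x i +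
      ∑ i ∈ Finset.range L, ∑ j ∈ Finset.range L,
        if k ≤ Nat.dist i j then x i * x j else 0 := by
  rw [sq, Finset.sum_mul_sum, Finset.mul_sum, ← Finset.sum_add_distrib]
  refine Finset.sum_le_sum fun i hi => ?_
  calc ∑ j ∈ Finset.range L, x i * x j
      ≤ ∑ j ∈ Finset.range L, (x i * (if Nat.dist i j < k then 1 else 0) +
          if k ≤ Nat.dist i j then x i * x j else 0) := by
        refine Finset.sum_le_sum fun j _ => ?_
        rcases lt_or_ge (Nat.dist i j) k with hlt | hge
        · simpa [hlt, hlt.not_ge] using mul_le_mul_of_nonneg_left (h1 j) (h0 i)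
        · simp [hge, hge.not_gt]
    _ ≤ 2 * k * x i + ∑ j ∈ Finset.range L, if k ≤ Nat.dist i j then x i * x j else 0 := by
        rw [Finset.sum_add_distrib, ← Finset.mul_sum, mul_comm (x i)]
        gcongr
        · exact h0 i
        · exact sum_dist_lt_le (Finset.mem_range.1 hi) k

/-- The number of ordered pairs of times in `{0, …, L - 1}`, at least `k` apart, at which the
process visits `D`. -/
noncomputable def farPairs (X : ℤ → Ω → EuclideanSpace ℝ (Fin d))
    (D : Set (EuclideanSpace ℝ (Fin d))) (k L : ℕ) (ω : Ω) : ℝ :=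
  ∑ i ∈ Finset.range L, ∑ j ∈ Finset.range L,
    if k ≤ Nat.dist i j then (X i ⁻¹' D ∩ X j ⁻¹' D).indicator 1 ω else 0

omit [MeasurableSpace Ω] in
theorem farPairs_nonneg (k L : ℕ) (ω : Ω) : 0 ≤ farPairs X D k L ω :=
  Finset.sum_nonneg fun i _ => Finset.sum_nonneg fun j _ => by
    split_ifs
    exacts [Set.indicator_nonneg (fun _ _ => zero_le_one) _, le_rfl]

theorem sq_sum_centred_le_farPairs {k L : ℕ} (hp : L * P.real (X 0 ⁻¹' D) ≤ 1) {x : ℝ}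
    (hx : 1 ≤ x) (hk : 4 * k ≤ x) {ω : Ω}
    (hω : x < |∑ t ∈ Finset.range L, centred P X D t ω|) :
    (∑ t ∈ Finset.range L, centred P X D t ω) ^ 2 ≤ 2 * farPairs X D k L ω := by
  set N := ∑ t ∈ Finset.range L, (X t ⁻¹' D).indicator (1 : Ω → ℝ) ω
  have hN : 0 ≤ N := Finset.sum_nonneg fun t _ => Set.indicator_nonneg (fun _ _ => zero_le_one) _
  have hsum : ∑ t ∈ Finset.range L, centred P X D t ω = N - L * P.real (X 0 ⁻¹' D) := by
    simp [centred, N, Finset.sum_sub_distrib]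
  have hpairs : N ^ 2 ≤ 2 * k * N + farPairs X D k L ω := by
    simpa only [farPairs, Set.inter_indicator_one, Pi.mul_apply] using
      sq_sum_le_add_sum_dist (x := fun t : ℕ => (X t ⁻¹' D).indicator (1 : Ω → ℝ) ω)
        (fun t => Set.indicator_nonneg (fun _ _ => zero_le_one) _)
        (fun t => Set.indicator_le_self' (fun _ _ => zero_le_one) _) k L
  have hp0 : 0 ≤ L * P.real (X 0 ⁻¹' D) := by positivity
  rw [hsum] at hω ⊢
  rcases lt_abs.1 hω with hpos | hneg
  · have : 4 * (k : ℝ) * N ≤ N * N := by gcongr; linarith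
    nlinarith
  · linarith

variable [IsProbabilityMeasure P]

theorem integrable_indicator_inter (hX : ∀ t, Measurable (X t)) (hD : MeasurableSet D) (s t : ℤ) :
    Integrable ((X s ⁻¹' D ∩ X t ⁻¹' D).indicator (1 : Ω → ℝ)) P :=
  (integrable_const (1 : ℝ)).indicator ((hX s hD).inter (hX t hD))

theorem integrable_farPairs (hX : ∀ t, Measurable (X t)) (hD : MeasurableSet D) (k L : ℕ) :
    Integrable (farPairs X D k L) P :=
  integrable_finsetSum _ fun i _ => integrable_finsetSum _ fun j _ => by
    split_ifs
    exacts [integrable_indicator_inter hX hD i j, integrable_zero _ _ _]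

theorem integral_farPairs_le (hX : ∀ t, Measurable (X t)) (hstat : StrictlyStationary P X)
    (hD : MeasurableSet D) (k L : ℕ) :
    ∫ ω, farPairs X D k L ω ∂P ≤
      2 * L * ∑ h ∈ Finset.Ico k L, P.real (X 0 ⁻¹' D ∩ X h ⁻¹' D) := by
  set g : ℕ → ℝ := fun h => if k ≤ h then P.real (X 0 ⁻¹' D ∩ X h ⁻¹' D) else 0 with hg
  have hg0 : ∀ h, 0 ≤ g h := fun h => by simp only [hg]; split_ifs <;> positivity
  have hpair : ∀ i j : ℕ, ∫ ω, (if k ≤ Nat.dist i j then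
      (X i ⁻¹' D ∩ X j ⁻¹' D).indicator (1 : Ω → ℝ) ω else 0) ∂P = g (Nat.dist i j) := fun i j => by
    simp only [hg]
    split_ifs
    · rw [integral_indicator_one ((hX i hD).inter (hX j hD)), hstat.measureReal_preimage_inter hD]
    · exact integral_zero _ _
  have hintegrable : ∀ i j : ℕ, Integrable (fun ω => if k ≤ Nat.dist i j then
      (X i ⁻¹' D ∩ X j ⁻¹' D).indicator (1 : Ω → ℝ) ω else 0) P := fun i j => by
    split_ifs
    exacts [integrable_indicator_inter hX hD i j, integrable_zero _ _ _]
  calc ∫ ω, farPairs X D k L ω ∂P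
      = ∑ i ∈ Finset.range L, ∑ j ∈ Finset.range L, g (Nat.dist i j) := by
        unfold farPairs
        rw [integral_finsetSum _ fun i _ => integrable_finsetSum _ fun j _ => hintegrable i j]
        refine Finset.sum_congr rfl fun i _ => ?_
        rw [integral_finsetSum _ fun j _ => hintegrable i j]
        exact Finset.sum_congr rfl fun j _ => hpair i j
    _ ≤ ∑ i ∈ Finset.range L, 2 * ∑ h ∈ Finset.range L, g h :=
        Finset.sum_le_sum fun i hi => sum_dist_le hg0 (Finset.mem_range.1 hi)
    _ = 2 * L * ∑ h ∈ Finset.Ico k L, P.real (X 0 ⁻¹' D ∩ X h ⁻¹' D) := by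
        have hfilter : (Finset.range L).filter (k ≤ ·) = Finset.Ico k L := by
          ext h; simp [and_comm]
        rw [Finset.sum_const, Finset.card_range, nsmul_eq_mul, ← hfilter, Finset.sum_filter]
        ring

theorem setIntegral_sq_sum_centred_le (hX : ∀ t, Measurable (X t))
    (hstat : StrictlyStationary P X) (hD : MeasurableSet D) {k L : ℕ}
    (hp : L * P.real (X 0 ⁻¹' D) ≤ 1) {x : ℝ} (hx : 1 ≤ x) (hk : 4 * k ≤ x) :
    ∫ ω in {ω | x < |∑ t ∈ Finset.range L, centred P X D t ω|},
        (∑ t ∈ Finset.range L, centred P X D t ω) ^ 2 ∂P ≤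
      4 * L * ∑ h ∈ Finset.Ico k L, P.real (X 0 ⁻¹' D ∩ X h ⁻¹' D) := by
  have hS := measurable_sum_centred (P := P) hX hD (Finset.range L)
  have hsq : Integrable (fun ω => (∑ t ∈ Finset.range L, centred P X D t ω) ^ 2) P :=
    (MemLp.of_bound hS.aestronglyMeasurable _ (ae_of_all _ (abs_sum_centred_le _))).integrable_sq
  have hpairs : Integrable (fun ω => 2 * farPairs X D k L ω) P :=
    (integrable_farPairs hX hD k L).const_mul 2
  calc _ ≤ ∫ ω in {ω | x < |∑ t ∈ Finset.range L, centred P X D t ω|},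
        2 * farPairs X D k L ω ∂P :=
        setIntegral_mono_on hsq.integrableOn hpairs.integrableOn
          (measurableSet_lt measurable_const hS.abs) fun ω hω =>
          sq_sum_centred_le_farPairs hp hx hk hω
    _ ≤ ∫ ω, 2 * farPairs X D k L ω ∂P :=
        setIntegral_le_integral hpairs (ae_of_all _ fun ω =>
          mul_nonneg zero_le_two (farPairs_nonneg k L ω))
    _ ≤ 2 * (2 * L * ∑ h ∈ Finset.Ico k L, P.real (X 0 ⁻¹' D ∩ X h ⁻¹' D)) := by
        rw [integral_const_mul]
        gcongr
        exact integral_farPairs_le hX hstat hD k L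
    _ = _ := by ring

end Lindeberg

section ArrayLimit

variable {Ω : Type*} [MeasurableSpace Ω] {P : Measure Ω} [IsProbabilityMeasure P] {d : ℕ}
  {X : ℤ → Ω → EuclideanSpace ℝ (Fin d)} {D : ℕ → Set (EuclideanSpace ℝ (Fin d))}
  {m r L K : ℕ → ℕ} {x a τ : ℕ → ℝ} {q : ℝ}

theorem tendsto_block_variance (hX : ∀ t, Measurable (X t)) (hstat : StrictlyStationary P X)
    (hD : ∀ n, MeasurableSet (D n)) (hL : Tendsto L atTop atTop)
    (hlim : ∀ h, Tendsto (fun n => m n * lagCov P X (D n) h) atTop (𝓝 (τ h)))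
    (htail : UniformlySmallTails fun n h => m n * lagCov P X (D n) h) :
    Tendsto (fun n => (m n : ℝ) / L n *
        ∫ ω, (∑ t ∈ Finset.range (L n), centred P X (D n) t ω) ^ 2 ∂P) atTop
      (𝓝 (∑' h, lagWeight h * τ h)) := by
  set u : ℕ → ℕ → ℝ := fun n h => ((L n - h : ℕ) : ℝ) / L n *
    (lagWeight h * (m n * lagCov P X (D n) h)) with hu
  have hu_lim : ∀ h, Tendsto (fun n => u n h) atTop (𝓝 (lagWeight h * τ h)) := fun h => by
    have hratio : Tendsto (fun n => ((L n - h : ℕ) : ℝ) / L n) atTop (𝓝 1) := by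
      have hone : Tendsto (fun n => 1 - (h : ℝ) / L n) atTop (𝓝 1) := by
        simpa using (tendsto_const_nhds.div_atTop
          (tendsto_natCast_atTop_atTop.comp hL)).const_sub (1 : ℝ)
      refine hone.congr' ?_
      filter_upwards [hL.eventually_ge_atTop h, hL.eventually_ne_atTop 0] with n hn hn0
      rw [Nat.cast_sub hn, sub_div, div_self (Nat.cast_ne_zero.2 hn0)]
    simpa using hratio.mul ((hlim h).const_mul (lagWeight h))
  have hu_tail : UniformlySmallTails u := htail.of_abs_le_mul zero_lt_two fun n h => by
    have hratio : ((L n - h : ℕ) : ℝ) / L n ≤ 1 :=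
      div_le_one_of_le₀ (by exact_mod_cast Nat.sub_le _ _) (Nat.cast_nonneg _)
    rw [hu, abs_mul, abs_mul, abs_of_nonneg (lagWeight_nonneg h), abs_of_nonneg (by positivity)]
    exact (mul_le_of_le_one_left (mul_nonneg (lagWeight_nonneg h) (abs_nonneg _)) hratio).trans
      (mul_le_mul_of_nonneg_right (lagWeight_le_two h) (abs_nonneg _))
  refine (hu_tail.tendsto_sum_range hu_lim hL).congr fun n => ?_
  rw [integral_sq_sum_centred hX hstat (hD n), sum_sum_dist, Finset.mul_sum]
  refine Finset.sum_congr rfl fun h hh => ?_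
  simp only [hu]
  rw [Nat.cast_sub (Finset.mem_range.1 hh).le]
  ring

omit [IsProbabilityMeasure P] in
theorem mul_sum_measureReal_inter_le (D : Set (EuclideanSpace ℝ (Fin d))) {b : ℝ} (hb : 0 ≤ b)
    (k N : ℕ) : b * ∑ h ∈ Finset.Ico k N, P.real (X 0 ⁻¹' D ∩ X h ⁻¹' D) ≤
      ∑ h ∈ Finset.Ico k N, |b * lagCov P X D h| + b * (N * P.real (X 0 ⁻¹' D) ^ 2) := by
  have hcard : ((Finset.Ico k N).card : ℝ) ≤ N := by
    rw [Nat.card_Ico]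
    exact_mod_cast N.sub_le k
  calc _ = ∑ h ∈ Finset.Ico k N, b * lagCov P X D h +
        b * ((Finset.Ico k N).card * P.real (X 0 ⁻¹' D) ^ 2) := by
        rw [← nsmul_eq_mul, ← Finset.sum_const, Finset.mul_sum, Finset.mul_sum,
          ← Finset.sum_add_distrib]
        exact Finset.sum_congr rfl fun h _ => by rw [lagCov]; ring
    _ ≤ _ := by gcongr; exact le_abs_self _

theorem tendsto_block_truncated_variance (hX : ∀ t, Measurable (X t))
    (hstat : StrictlyStationary P X) (hD : ∀ n, MeasurableSet (D n)) (hL : Tendsto L atTop atTop)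
    (hLm : Tendsto (fun n => (L n : ℝ) / m n) atTop (𝓝 0)) (hm : Tendsto m atTop atTop)
    (hp : Tendsto (fun n => m n * P.real (X 0 ⁻¹' D n)) atTop (𝓝 q))
    (htail : UniformlySmallTails fun n h => m n * lagCov P X (D n) h)
    (hx : Tendsto x atTop atTop) :
    Tendsto (fun n => (m n : ℝ) / L n *
        ∫ ω in {ω | x n < |∑ t ∈ Finset.range (L n), centred P X (D n) t ω|},
          (∑ t ∈ Finset.range (L n), centred P X (D n) t ω) ^ 2 ∂P) atTop (𝓝 0) := by
  have hLp : Tendsto (fun n => L n * P.real (X 0 ⁻¹' D n)) atTop (𝓝 0) := by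
    have := hLm.mul hp
    rw [zero_mul] at this
    refine this.congr' ?_
    filter_upwards [hm.eventually_ne_atTop 0] with n hn
    have : (m n : ℝ) ≠ 0 := Nat.cast_ne_zero.2 hn
    field_simp
  have hsquare : Tendsto (fun n => m n * (L n * P.real (X 0 ⁻¹' D n) ^ 2)) atTop (𝓝 0) := by
    have := hLp.mul hp
    rw [zero_mul] at this
    exact this.congr fun n => by ring
  refine tendsto_zero_of_forall_eventually_le_mul (fun n => mul_nonneg (by positivity)
    (integral_nonneg fun ω => sq_nonneg _)) tendsto_const_nhds (x := fun _ => 0) fun δ hδ => ?_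
  obtain ⟨k, hk⟩ := htail (δ / 8) (by positivity)
  filter_upwards [hk, hsquare.eventually_le_const (show 0 < δ / 8 by positivity),
    hLp.eventually_le_const one_pos, hx.eventually_ge_atTop 1, hx.eventually_ge_atTop (4 * k),
    hL.eventually_ne_atTop 0] with n htail_n hsquare_n hLp_n hx_one hx_k hLn
  have hLn' : (L n : ℝ) ≠ 0 := Nat.cast_ne_zero.2 hLn
  calc _ ≤ (m n : ℝ) / L n *
        (4 * L n * ∑ h ∈ Finset.Ico k (L n), P.real (X 0 ⁻¹' D n ∩ X h ⁻¹' D n)) := by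
        gcongr
        exact setIntegral_sq_sum_centred_le hX hstat (hD n) hLp_n hx_one hx_k
    _ = 4 * (m n * ∑ h ∈ Finset.Ico k (L n), P.real (X 0 ⁻¹' D n ∩ X h ⁻¹' D n)) := by
        field_simp
    _ ≤ 4 * (δ / 8 + δ / 8) := by
        gcongr
        exact (mul_sum_measureReal_inter_le (D n) (Nat.cast_nonneg (m n)) k (L n)).trans
          (add_le_add (htail_n _) hsquare_n)
    _ = δ * (0 + 1) := by ring

end ArrayLimit

section BlockCharFun

variable {Ω : Type*} [MeasurableSpace Ω] {P : Measure Ω} [IsProbabilityMeasure P] {d : ℕ}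
  {X : ℤ → Ω → EuclideanSpace ℝ (Fin d)} {D : ℕ → Set (EuclideanSpace ℝ (Fin d))}
  {m r L K : ℕ → ℕ} {a τ : ℕ → ℝ} {q : ℝ}

theorem mul_sq_mul_sqrt_mul (u k b : ℝ) {M N l : ℕ} (hl : l ≠ 0) :
    k * ((u * √((M : ℝ) / N)) ^ 2 * b) = u ^ 2 * (k * l / N * (M / l * b)) := by
  have hl' : (l : ℝ) ≠ 0 := Nat.cast_ne_zero.2 hl
  rw [mul_pow, Real.sq_sqrt (by positivity)]
  field_simp

theorem memLp_sum_centred (hX : ∀ t, Measurable (X t)) {D : Set (EuclideanSpace ℝ (Fin d))}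
    (hD : MeasurableSet D) (T : Finset ℕ) (p : ℝ≥0∞) :
    MemLp (fun ω => ∑ t ∈ T, centred P X D t ω) p P :=
  .of_bound (measurable_sum_centred hX hD T).aestronglyMeasurable _
    (ae_of_all _ (abs_sum_centred_le T))

theorem tendsto_count_mul_block_variance (hB : BlockScheme m r a L K)
    (hX : ∀ t, Measurable (X t)) (hstat : StrictlyStationary P X) (hD : ∀ n, MeasurableSet (D n))
    (hlim : ∀ h, Tendsto (fun n => m n * lagCov P X (D n) h) atTop (𝓝 (τ h)))
    (htail : UniformlySmallTails fun n h => m n * lagCov P X (D n) h) (u : ℝ) :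
    Tendsto (fun n : ℕ => (K n : ℝ) * ∫ ω, (u * √((m n : ℝ) / n) *
        ∑ t ∈ Finset.range (L n), centred P X (D n) t ω) ^ 2 ∂P) atTop
      (𝓝 (u ^ 2 * ∑' h, lagWeight h * τ h)) := by
  have hprod := (hB.exhausts.mul (tendsto_block_variance hX hstat hD hB.length_tendsto
    hlim htail)).const_mul (u ^ 2)
  rw [one_mul] at hprod
  refine hprod.congr' ?_
  filter_upwards [hB.length_tendsto.eventually_ne_atTop 0] with n hn
  simp only [mul_pow _ (∑ _ ∈ Finset.range (L n), _), integral_const_mul]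
  exact (mul_sq_mul_sqrt_mul u _ _ hn).symm

theorem tendsto_count_mul_block_truncated_variance (hB : BlockScheme m r a L K)
    (hX : ∀ t, Measurable (X t)) (hstat : StrictlyStationary P X) (hD : ∀ n, MeasurableSet (D n))
    (hm : Tendsto m atTop atTop) (hmn : Tendsto (fun n : ℕ => (m n : ℝ) / n) atTop (𝓝 0))
    (hp : Tendsto (fun n => m n * P.real (X 0 ⁻¹' D n)) atTop (𝓝 q))
    (htail : UniformlySmallTails fun n h => m n * lagCov P X (D n) h) (u : ℝ) {δ : ℝ}
    (hδ : 0 < δ) :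
    Tendsto (fun n : ℕ => (K n : ℝ) * ∫ ω in {ω | δ < |u * √((m n : ℝ) / n) *
        ∑ t ∈ Finset.range (L n), centred P X (D n) t ω|}, (u * √((m n : ℝ) / n) *
        ∑ t ∈ Finset.range (L n), centred P X (D n) t ω) ^ 2 ∂P) atTop (𝓝 0) := by
  set b : ℕ → ℝ := fun n => (|u| + 1) * √((m n : ℝ) / n)
  have hb_pos : ∀ᶠ n in atTop, 0 < b n := by
    filter_upwards [hm.eventually_gt_atTop 0, eventually_gt_atTop 0] with n hmn hn
    positivity
  have hb : Tendsto b atTop (𝓝[>] 0) := by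
    refine tendsto_nhdsWithin_iff.2 ⟨?_, hb_pos⟩
    simpa [b, Function.comp_def] using
      ((Real.continuous_sqrt.tendsto 0).comp hmn).const_mul (|u| + 1)
  have hx : Tendsto (fun n => δ / b n) atTop atTop := by
    simpa only [div_eq_mul_inv, Pi.inv_apply] using hb.inv_tendsto_nhdsGT_zero.const_mul_atTop hδ
  have hprod := (hB.exhausts.mul (tendsto_block_truncated_variance hX hstat hD hB.length_tendsto
    hB.length_div hm hp htail hx)).const_mul (u ^ 2)
  rw [one_mul, mul_zero] at hprod
  refine squeeze_zero' (.of_forall fun n => mul_nonneg (Nat.cast_nonneg _)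
    (integral_nonneg fun ω => sq_nonneg _)) ?_ hprod
  filter_upwards [hB.length_tendsto.eventually_ne_atTop 0, hb_pos] with n hn hbn
  simp only [mul_pow _ (∑ _ ∈ Finset.range (L n), _), integral_const_mul]
  rw [← mul_sq_mul_sqrt_mul u _ _ hn]
  gcongr _ * (_ * ?_)
  refine setIntegral_mono_set (memLp_sum_centred hX (hD n) _ 2).integrable_sq.integrableOn
    (ae_of_all _ fun ω => sq_nonneg _) (.of_forall fun ω (hω : δ < |_ * _|) => ?_)
  refine (div_lt_iff₀' hbn).2 (hω.trans_le ?_)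
  rw [abs_mul, abs_mul, abs_of_nonneg (Real.sqrt_nonneg _)]
  gcongr
  exact mul_le_mul_of_nonneg_right (le_add_of_nonneg_right zero_le_one) (Real.sqrt_nonneg _)

theorem tendsto_block_charFun_pow (hB : BlockScheme m r a L K)
    (hX : ∀ t, Measurable (X t)) (hstat : StrictlyStationary P X) (hD : ∀ n, MeasurableSet (D n))
    (hm : Tendsto m atTop atTop) (hmn : Tendsto (fun n : ℕ => (m n : ℝ) / n) atTop (𝓝 0))
    (hp : Tendsto (fun n => m n * P.real (X 0 ⁻¹' D n)) atTop (𝓝 q))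
    (hlim : ∀ h, Tendsto (fun n => m n * lagCov P X (D n) h) atTop (𝓝 (τ h)))
    (htail : UniformlySmallTails fun n h => m n * lagCov P X (D n) h) (u : ℝ) :
    Tendsto (fun n : ℕ => (∫ ω, Complex.exp ((u * √((m n : ℝ) / n) *
        ∑ t ∈ Finset.range (L n), centred P X (D n) t ω : ℝ) * Complex.I) ∂P) ^ K n) atTop
      (𝓝 (Complex.exp (-(u ^ 2 * (∑' h, lagWeight h * τ h) / 2 : ℝ)))) := by
  refine tendsto_integral_exp_pow_of_lindeberg
    (fun n => (memLp_sum_centred hX (hD n) _ 2).const_mul _) (fun n => ?_) hB.count_tendsto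
    (tendsto_count_mul_block_variance hB hX hstat hD hlim htail u)
    fun δ hδ => tendsto_count_mul_block_truncated_variance hB hX hstat hD hm hmn hp htail u hδ
  rw [integral_const_mul, integral_sum_centred hX hstat (hD n), mul_zero]

omit [IsProbabilityMeasure P] in
theorem tendsto_remainder_variance (hB : BlockScheme m r a L K)
    (hlim : ∀ h, Tendsto (fun n => m n * lagCov P X (D n) h) atTop (𝓝 (τ h)))
    (htail : UniformlySmallTails fun n h => m n * lagCov P X (D n) h) (u : ℝ) :
    Tendsto (fun n : ℕ => (u * √((m n : ℝ) / n)) ^ 2 * ((n - K n * L n : ℕ) *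
      (2 * ∑ h ∈ Finset.range (n + 1), |lagCov P X (D n) h|))) atTop (𝓝 0) := by
  obtain ⟨b, hb⟩ := htail.exists_eventually_sum_range_le hlim
  have hbound : Tendsto (fun n : ℕ => u ^ 2 * ((1 - (K n : ℝ) * L n / n) * (2 * b))) atTop
      (𝓝 0) := by
    simpa using ((hB.exhausts.const_sub 1).mul_const (2 * b)).const_mul (u ^ 2)
  refine squeeze_zero' (.of_forall fun n => by positivity) ?_ hbound
  filter_upwards [hb, eventually_ne_atTop 0] with n hbn hn
  have hn' : (n : ℝ) ≠ 0 := Nat.cast_ne_zero.2 hn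
  have hfit : K n * L n ≤ n :=
    (Nat.mul_le_mul_left _ (Nat.le_add_right _ _)).trans (hB.fits n)
  have hratio : (0 : ℝ) ≤ 1 - K n * L n / n :=
    sub_nonneg.2 (div_le_one_of_le₀ (by exact_mod_cast hfit) (Nat.cast_nonneg n))
  calc _ = u ^ 2 * ((1 - (K n : ℝ) * L n / n) *
        (2 * ∑ h ∈ Finset.range (n + 1), |m n * lagCov P X (D n) h|)) := by
        simp only [abs_mul, Nat.abs_cast, ← Finset.mul_sum]
        rw [mul_pow, Real.sq_sqrt (by positivity), Nat.cast_sub hfit]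
        push_cast
        field_simp
    _ ≤ _ := by gcongr; exact hbn _

theorem tendsto_charFun_array (hX : ∀ t, Measurable (X t)) (hstat : StrictlyStationary P X)
    (hD : ∀ n, MeasurableSet (D n)) (hm : Tendsto m atTop atTop)
    (hmn : Tendsto (fun n : ℕ => (m n : ℝ) / n) atTop (𝓝 0))
    (hrm : Tendsto (fun n : ℕ => (r n : ℝ) / m n) atTop (𝓝 0))
    (hkr : Tendsto (fun n : ℕ => (n : ℝ) / m n * alphaCoeff P X (r n)) atTop (𝓝 0))
    (hp : Tendsto (fun n => m n * P.real (X 0 ⁻¹' D n)) atTop (𝓝 q))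
    (hlim : ∀ h, Tendsto (fun n => m n * lagCov P X (D n) h) atTop (𝓝 (τ h)))
    (htail : UniformlySmallTails fun n h => m n * lagCov P X (D n) h) (u : ℝ) :
    Tendsto (fun n : ℕ => ∫ ω, Complex.exp ((u * √((m n : ℝ) / n) *
        ∑ t ∈ Finset.Icc 1 n, centred P X (D n) t ω : ℝ) * Complex.I) ∂P) atTop
      (𝓝 (Complex.exp (-(u ^ 2 * (∑' h, lagWeight h * τ h) / 2 : ℝ)))) := by
  obtain ⟨L, K, hB⟩ := exists_blockScheme hm hmn hrm (fun n => alphaCoeff_nonneg (r n)) hkr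
  have hgaps := (Real.continuous_sqrt.tendsto 0).comp (tendsto_remainder_variance hB hlim htail u)
  have hdecouple := hB.cost.const_mul 16
  rw [Real.sqrt_zero] at hgaps
  refine (tendsto_block_charFun_pow hB hX hstat hD hm hmn hp hlim htail u).congr_dist ?_
  refine squeeze_zero (fun n => dist_nonneg) (fun n => ?_)
    (by simpa only [mul_zero, add_zero] using hgaps.add hdecouple)
  rw [dist_comm]
  refine (dist_triangle _ _ _).trans (add_le_add (dist_eq_norm _ _ |>.trans_le
    (norm_integral_exp_sub_blocks_le hX hstat (hD n) _ (hB.fits n))) ?_)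
  rw [dist_eq_norm]
  exact (norm_integral_exp_blocks_sub_pow_le hX hstat (hD n) _ _ _ _).trans_eq (by ring)

end BlockCharFun

section Assumptions

variable {Ω : Type*} [MeasurableSpace Ω] {P : Measure Ω} [IsProbabilityMeasure P] {d : ℕ}
  {X : ℤ → Ω → EuclideanSpace ℝ (Fin d)} {D : ℕ → Set (EuclideanSpace ℝ (Fin d))}
  {a : ℕ → ℝ} {m r : ℕ → ℕ} {q : ℝ}

omit [IsProbabilityMeasure P] in
theorem tendsto_mul_lagCov (hm : Tendsto m atTop atTop)
    (hp : Tendsto (fun n => m n * P.real (X 0 ⁻¹' D n)) atTop (𝓝 q)) {h : ℕ} {t : ℝ}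
    (hjoint : Tendsto (fun n => m n * P.real (X 0 ⁻¹' D n ∩ X h ⁻¹' D n)) atTop (𝓝 t)) :
    Tendsto (fun n => m n * lagCov P X (D n) h) atTop (𝓝 t) := by
  have hinv : Tendsto (fun n => (m n : ℝ)⁻¹) atTop (𝓝 0) :=
    tendsto_inv_atTop_zero.comp (tendsto_natCast_atTop_atTop.comp hm)
  have hdiff := hjoint.sub ((hp.mul hp).mul hinv)
  rw [mul_zero, sub_zero] at hdiff
  refine hdiff.congr' ?_
  filter_upwards [hm.eventually_ne_atTop 0] with n hn
  have : (m n : ℝ) ≠ 0 := Nat.cast_ne_zero.2 hn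
  rw [lagCov]
  field_simp

theorem ConditionM.exists_mul_sum_measureReal_inter_le (hM : ConditionM P X a m r) {ε : ℝ}
    (hε : 0 < ε) (hDε : ∀ᶠ n in atTop, D n ⊆ {v | ε * a (m n) < ‖v‖}) {δ : ℝ} (hδ : 0 < δ) :
    ∃ k, ∀ᶠ n in atTop,
      m n * ∑ h ∈ Finset.Icc k (r n), P.real (X 0 ⁻¹' D n ∩ X h ⁻¹' D n) ≤ δ := by
  obtain ⟨k, hk⟩ := ((hM.anticlustering ε hε).eventually_lt_const
    (ENNReal.ofReal_pos.2 hδ)).exists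
  refine ⟨k, ?_⟩
  filter_upwards [eventually_lt_of_limsup_lt hk, hDε] with n hn hDn
  refine (ENNReal.ofReal_le_ofReal_iff hδ.le).1 (le_trans ?_ hn.le)
  rw [ENNReal.ofReal_mul (Nat.cast_nonneg _), ENNReal.ofReal_natCast,
    ENNReal.ofReal_sum_of_nonneg fun _ _ => measureReal_nonneg]
  gcongr with h
  rw [ofReal_measureReal]
  exact measure_mono fun ω hω => ⟨hDn hω.2, hDn hω.1⟩

theorem sum_abs_lagCov_le (hstat : StrictlyStationary P X)
    {D : Set (EuclideanSpace ℝ (Fin d))} (hD : MeasurableSet D)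
    (hα : Summable (alphaCoeff P X)) (k r N : ℕ) :
    ∑ h ∈ Finset.Ico k N, |lagCov P X D h| ≤
      ∑ h ∈ Finset.Icc k r, P.real (X 0 ⁻¹' D ∩ X h ⁻¹' D) +
        (r + 1) * P.real (X 0 ⁻¹' D) ^ 2 + ∑' j, alphaCoeff P X (r + j) := by
  have hsubset : Finset.Ico k N ⊆ Finset.Icc k r ∪ Finset.Ico r N := fun h hh => by
    simp only [Finset.mem_union, Finset.mem_Ico, Finset.mem_Icc] at hh ⊢
    omega
  have hsplit : ∑ h ∈ Finset.Ico k N, |lagCov P X D h| ≤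
      ∑ h ∈ Finset.Icc k r, |lagCov P X D h| + ∑ h ∈ Finset.Ico r N, |lagCov P X D h| := by
    rw [← Finset.sum_union_inter]
    exact (Finset.sum_le_sum_of_subset_of_nonneg hsubset fun _ _ _ => abs_nonneg _).trans
      (le_add_of_nonneg_right (Finset.sum_nonneg fun _ _ => abs_nonneg _))
  have hcard : ((Finset.Icc k r).card : ℝ) ≤ r + 1 := by
    rw [Nat.card_Icc]
    exact_mod_cast Nat.sub_le _ _
  refine hsplit.trans (add_le_add ?_ ?_)
  · refine (Finset.sum_le_sum fun h _ => abs_lagCov_le h).trans ?_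
    rw [Finset.sum_add_distrib, Finset.sum_const, nsmul_eq_mul]
    gcongr
  · rw [Finset.sum_Ico_eq_sum_range]
    refine (Finset.sum_le_sum fun j _ => abs_lagCov_le_alphaCoeff hstat hD (r + j)).trans ?_
    have htail : Summable fun j => alphaCoeff P X (r + j) := by
      simpa only [add_comm] using (summable_nat_add_iff r).2 hα
    exact htail.sum_le_tsum _ fun j _ => alphaCoeff_nonneg _

theorem ConditionM.uniformlySmallTails (hM : ConditionM P X a m r)
    (hstat : StrictlyStationary P X) (hD : ∀ n, MeasurableSet (D n)) {ε : ℝ} (hε : 0 < ε)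
    (hDε : ∀ᶠ n in atTop, D n ⊆ {v | ε * a (m n) < ‖v‖})
    (hp : Tendsto (fun n => m n * P.real (X 0 ⁻¹' D n)) atTop (𝓝 q)) :
    UniformlySmallTails fun n h => m n * lagCov P X (D n) h := by
  intro δ hδ
  have hsquare : Tendsto (fun n => m n * ((r n + 1) * P.real (X 0 ⁻¹' D n) ^ 2)) atTop (𝓝 0) := by
    have hinv : Tendsto (fun n => (m n : ℝ)⁻¹) atTop (𝓝 0) :=
      tendsto_inv_atTop_zero.comp (tendsto_natCast_atTop_atTop.comp hM.m_tendsto)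
    have hprod := (hp.pow 2).mul (hM.r_div_m.add hinv)
    rw [add_zero, mul_zero] at hprod
    refine hprod.congr' ?_
    filter_upwards [hM.m_tendsto.eventually_ne_atTop 0] with n hn
    have : (m n : ℝ) ≠ 0 := Nat.cast_ne_zero.2 hn
    field_simp
  obtain ⟨k, hk⟩ := hM.exists_mul_sum_measureReal_inter_le hε hDε (show 0 < δ / 3 by positivity)
  refine ⟨k, ?_⟩
  filter_upwards [hk, hsquare.eventually_le_const (show 0 < δ / 3 by positivity),
    hM.tail_sum.eventually_le_const (show 0 < δ / 3 by positivity)] with n hanti hsq htail N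
  have hsum := mul_le_mul_of_nonneg_left (sum_abs_lagCov_le hstat (hD n) hM.summable k (r n) N)
    (Nat.cast_nonneg (α := ℝ) (m n))
  simp only [abs_mul, Nat.abs_cast, ← Finset.mul_sum]
  linarith

theorem RegularlyVarying.exists_forall_tendsto_lagNorm_div_norm {α : ℝ}
    {μ : (h : ℕ) → Measure (Punctured h d)} (hreg : RegularlyVarying P X α μ)
    (hX : ∀ t, Measurable (X t)) (hstat : StrictlyStationary P X) :
    ∃ c : ℕ → ℝ≥0, ∀ h, 1 ≤ h → 0 < c h ∧
      Tendsto (fun x : ℝ => P.real {ω | x < lagNorm X h ω} / P.real {ω | x < ‖X 0 ω‖})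
        atTop (𝓝 (c h : ℝ)) := by
  have hex : ∀ h : ℕ, ∃ c : ℝ≥0, 1 ≤ h → 0 < c ∧
      Tendsto (fun x : ℝ => P.real {ω | x < lagNorm X h ω} / P.real {ω | x < ‖X 0 ω‖})
        atTop (𝓝 (c : ℝ)) := fun h => by
    rcases Nat.eq_zero_or_pos h with rfl | hh
    · exact ⟨0, fun h => absurd h (by omega)⟩
    · exact (hreg.exists_tendsto_lagNorm_div_norm hX hstat hh).imp fun c hc _ => hc
  choose c hc using hex
  exact ⟨c, hc⟩

theorem BoundedAwayFromZero.exists_eventually_preimage_subset {C : Set (Fin d → EReal)}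
    (hC0 : BoundedAwayFromZero C) {x : ℕ → ℝ} (hx : Tendsto x atTop atTop) :
    ∃ ε : ℝ, 0 < ε ∧ ∀ᶠ n in atTop, scaledPoint (x n) ⁻¹' C ⊆ {v | ε * x n < ‖v‖} := by
  obtain ⟨ε, hε, hCε⟩ := hC0
  refine ⟨ε, hε, ?_⟩
  filter_upwards [hx.eventually_gt_atTop 0] with n hn v hv
  have hnorm : ENNReal.ofReal ε < extNorm (scaledPoint (x n) v) := hCε hv
  rwa [extNorm_scaledPoint hn, ENNReal.ofReal_lt_ofReal_iff_of_nonneg hε.le,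
    lt_div_iff₀ hn] at hnorm

end Assumptions

section SigmaSq

variable {d : ℕ} {c : ℕ → ℝ≥0} {μ : (h : ℕ) → Measure (Punctured h d)}
  {C : Set (Fin d → EReal)}

theorem sigmaSq_eq (hc : c 1 = 1) : sigmaSq c μ C = tau c μ C 0 + 2 * ∑' h, tau c μ C (h + 1) := by
  have hzero : tau c μ C 0 = c 1 * μ 1 (lagSet C 0) := rfl
  rw [sigmaSq, hzero, hc, ENNReal.coe_one, one_mul]

theorem sigmaSq_ne_top (hc : c 1 = 1) (hfin : ∀ h, tau c μ C h ≠ ∞)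
    (hs : Summable fun h => (tau c μ C h).toReal) : sigmaSq c μ C ≠ ∞ := by
  have htsum : ∑' h, tau c μ C (h + 1) ≠ ∞ := by
    rw [tsum_congr fun h => (ENNReal.ofReal_toReal (hfin (h + 1))).symm]
    exact ((summable_nat_add_iff 1).2 hs).tsum_ofReal_ne_top
  rw [sigmaSq_eq hc]
  exact ENNReal.add_ne_top.2 ⟨hfin 0, ENNReal.mul_ne_top ENNReal.ofNat_ne_top htsum⟩

theorem toReal_sigmaSq (hc : c 1 = 1) (hfin : ∀ h, tau c μ C h ≠ ∞)
    (hs : Summable fun h => (tau c μ C h).toReal) :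
    (sigmaSq c μ C).toReal = ∑' h, lagWeight h * (tau c μ C h).toReal := by
  have hw : Summable fun h => lagWeight h * (tau c μ C h).toReal :=
    .of_nonneg_of_le (fun h => mul_nonneg (lagWeight_nonneg h) ENNReal.toReal_nonneg)
      (fun h => mul_le_mul_of_nonneg_right (lagWeight_le_two h) ENNReal.toReal_nonneg)
      (hs.mul_left 2)
  have hne := sigmaSq_ne_top hc hfin hs
  rw [sigmaSq_eq hc, ENNReal.add_ne_top] at hne
  rw [sigmaSq_eq hc, ENNReal.toReal_add hne.1 hne.2, ENNReal.toReal_mul,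
    ENNReal.tsum_toReal_eq fun h => hfin _, hw.tsum_eq_zero_add, ← tsum_mul_left]
  simp [lagWeight]

end SigmaSq

theorem tendstoInDistribution_gaussianReal_of_charFun {Ω : Type*} [MeasurableSpace Ω]
    {P : Measure Ω} [IsProbabilityMeasure P] {S : ℕ → Ω → ℝ} (hS : ∀ n, Measurable (S n))
    {v : ℝ≥0} (h : ∀ u : ℝ, Tendsto (fun n => ∫ ω, Complex.exp ((u * S n ω : ℝ) * Complex.I) ∂P)
      atTop (𝓝 (Complex.exp (-(u ^ 2 * v / 2 : ℝ))))) :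
    TendstoInDistribution S atTop id (fun _ => P) (gaussianReal 0 v) where
  forall_aemeasurable n := (hS n).aemeasurable
  aemeasurable_limit := aemeasurable_id
  tendsto := by
    refine ProbabilityMeasure.tendsto_iff_tendsto_charFun.2 fun u => ?_
    simp only [ProbabilityMeasure.coe_mk, Measure.map_id, charFun_gaussianReal]
    convert h u using 1
    · funext n
      rw [charFun_apply_real, integral_map (hS n).aemeasurable (by fun_prop)]
      simp only [Complex.ofReal_mul]
    · congr 2
      push_cast
      ring

theorem tendstoInDistribution_normalizedSum {Ω : Type*} [MeasurableSpace Ω] {P : Measure Ω}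
    [IsProbabilityMeasure P] {d : ℕ} {X : ℤ → Ω → EuclideanSpace ℝ (Fin d)} {a : ℕ → ℝ}
    {m r : ℕ → ℕ} {C : Set (Fin d → EReal)} {q : ℝ} {τ : ℕ → ℝ} {v : ℝ≥0}
    (hX : ∀ t, Measurable (X t)) (hstat : StrictlyStationary P X) (hC : MeasurableSet C)
    (hM : ConditionM P X a m r)
    (hkr : Tendsto (fun n : ℕ => (n : ℝ) / m n * alphaCoeff P X (r n)) atTop (𝓝 0))
    (hp : Tendsto (fun n => m n * P.real (X 0 ⁻¹' (scaledPoint (a (m n)) ⁻¹' C))) atTop (𝓝 q))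
    (hlim : ∀ h, Tendsto (fun n => m n * lagCov P X (scaledPoint (a (m n)) ⁻¹' C) h) atTop
      (𝓝 (τ h)))
    (htail : UniformlySmallTails fun n h => m n * lagCov P X (scaledPoint (a (m n)) ⁻¹' C) h)
    (hv : v = ∑' h, lagWeight h * τ h) :
    TendstoInDistribution (normalizedSum P X a m C) atTop id (fun _ => P) (gaussianReal 0 v) := by
  have hD : ∀ n, MeasurableSet (scaledPoint (d := d) (a (m n)) ⁻¹' C) := fun n =>
    measurable_scaledPoint _ hC
  have hsum : ∀ n ω, normalizedSum P X a m C n ω = √((m n : ℝ) / n) *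
      ∑ t ∈ Finset.Icc 1 n, centred P X (scaledPoint (a (m n)) ⁻¹' C) t ω := fun n ω => rfl
  refine tendstoInDistribution_gaussianReal_of_charFun (fun n => ?_) fun u => ?_
  · rw [funext (hsum n)]
    exact (measurable_sum_centred hX (hD n) _).const_mul _
  · simp only [hsum, ← mul_assoc, hv]
    exact tendsto_charFun_array hX hstat hD hM.m_tendsto hM.m_div_n hM.r_div_m hkr hp hlim htail u

end Extremogram

open Extremogram in
theorem theorem3p2_general {Ω : Type*} [MeasurableSpace Ω] (P : Measure Ω) [IsProbabilityMeasure P]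
    {d : ℕ} (X : ℤ → Ω → EuclideanSpace ℝ (Fin d)) (hX : ∀ t, Measurable (X t))
    (hstat : StrictlyStationary P X)
    (α : ℝ) (μ : (h : ℕ) → Measure (Punctured h d)) (hreg : RegularlyVarying P X α μ)
    (a : ℕ → ℝ) (ha : Tendsto (fun n : ℕ => (n : ℝ) * P.real {ω | a n < ‖X 0 ω‖}) atTop (𝓝 1))
    (C : Set (Fin d → EReal)) (hC : MeasurableSet C) (hC0 : BoundedAwayFromZero C)
    (hcont : ∀ h : ℕ, μ (h + 1) (frontier (lagSet C h)) = 0)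
    (m r : ℕ → ℕ) (hM : ConditionM P X a m r)
    (hkr : Tendsto (fun n : ℕ => (n : ℝ) / m n * alphaCoeff P X (r n)) atTop (𝓝 0)) :
    ∃ c : ℕ → ℝ≥0,
      (∀ h, 1 ≤ h → 0 < c h ∧
        Tendsto (fun x : ℝ => P.real {ω | x < lagNorm X h ω} / P.real {ω | x < ‖X 0 ω‖})
          atTop (𝓝 (c h : ℝ))) ∧
      sigmaSq c μ C ≠ ∞ ∧
      TendstoInDistribution (normalizedSum P X a m C) atTop id (fun _ => P)
        (gaussianReal 0 (sigmaSq c μ C).toNNReal) := by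
  obtain ⟨c, hc⟩ := hreg.exists_forall_tendsto_lagNorm_div_norm hX hstat
  have hc1 : c 1 = 1 := by exact_mod_cast hreg.eq_one_of_tendsto hX hstat (hc 1 le_rfl).2
  have hfin : ∀ h, tau c μ C h ≠ ∞ := hreg.tau_ne_top hC0 c
  have hjoint : ∀ h : ℕ, Tendsto (fun n => m n * P.real (X 0 ⁻¹' (scaledPoint (a (m n)) ⁻¹' C) ∩
      X h ⁻¹' (scaledPoint (a (m n)) ⁻¹' C))) atTop (𝓝 (tau c μ C h).toReal) := fun h =>
    (hreg.tendsto_joint_exceedance hX hstat ha hC hC0 (hcont h) (hc (h + 1) h.succ_pos).2).comp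
      hM.m_tendsto
  have hp : Tendsto (fun n => m n * P.real (X 0 ⁻¹' (scaledPoint (a (m n)) ⁻¹' C))) atTop
      (𝓝 (tau c μ C 0).toReal) := by
    simpa only [Nat.cast_zero, Set.inter_self] using hjoint 0
  have hlim := fun h => tendsto_mul_lagCov hM.m_tendsto hp (hjoint h)
  obtain ⟨ε, hε, hsubset⟩ := hC0.exists_eventually_preimage_subset
    ((hreg.threshold_tendsto_atTop hX hstat ha).comp hM.m_tendsto)
  have htail := hM.uniformlySmallTails hstat (fun n => measurable_scaledPoint _ hC) hε hsubset hp
  have hs := htail.summable hlim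
  exact ⟨c, hc, sigmaSq_ne_top hc1 hfin hs, tendstoInDistribution_normalizedSum hX hstat hC hM hkr
    hp hlim htail (toReal_sigmaSq hc1 hfin hs)⟩

open Extremogram in
theorem theorem3p2 {Ω : Type*} [MeasurableSpace Ω] (P : Measure Ω) [IsProbabilityMeasure P]
    {d : ℕ} (X : ℤ → Ω → EuclideanSpace ℝ (Fin d)) (hX : ∀ t, Measurable (X t))
    (hstat : StrictlyStationary P X)
    (α : ℝ) (μ : (h : ℕ) → Measure (Punctured h d)) (hreg : RegularlyVarying P X α μ)
    (a : ℕ → ℝ) (ha : Tendsto (fun n : ℕ => (n : ℝ) * P.real {ω | a n < ‖X 0 ω‖}) atTop (𝓝 1))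
    (C : Set (Fin d → EReal)) (hC : MeasurableSet C) (hC0 : BoundedAwayFromZero C)
    (hcont : ∀ h : ℕ, μ (h + 1) (frontier (lagSet C h)) = 0)
    (m r : ℕ → ℕ) (hM : ConditionM P X a m r)
    (hkr : Tendsto (fun n : ℕ => (n : ℝ) / m n * alphaCoeff P X (r n)) atTop (𝓝 0))
    (hgrowth :
      ((fun n : ℕ => (m n : ℝ)) =o[atTop] fun n : ℕ => (n : ℝ) ^ (1 / 3 : ℝ)) ∨
      (Tendsto (fun n : ℕ => (m n : ℝ) ^ 4 / n * ∑ j ∈ Finset.Icc (r n) (m n), alphaCoeff P X j)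
          atTop (𝓝 0) ∧
        Tendsto (fun n : ℕ => (m n : ℝ) * (r n : ℝ) ^ 3 / n) atTop (𝓝 0))) :
    ∃ c : ℕ → ℝ≥0,
      (∀ h, 1 ≤ h → 0 < c h ∧
        Tendsto (fun x : ℝ => P.real {ω | x < lagNorm X h ω} / P.real {ω | x < ‖X 0 ω‖})
          atTop (𝓝 (c h : ℝ))) ∧
      sigmaSq c μ C ≠ ∞ ∧
      TendstoInDistribution (normalizedSum P X a m C) atTop id (fun _ => P)
        (gaussianReal 0 (sigmaSq c μ C).toNNReal) :=
  theorem3p2_general P X hX hstat α μ hreg a ha C hC hC0 hcont m r hM hkr
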